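/- Let \(n\ge 1\), let \(m>2\) be a prime, and for \(k\ge1\) let \(a_1^{(k)},\dots,a_n^{(k)}\in\mathbb Z\) and let \(R_k\in M_n(\mathbb Z)\) be the upper-triangular matrix \[ R_k=\begin{pmatrix} a_1^{(k)} & a_1^{(k)} & \cdots & a_1^{(k)}\\ 0 & a_2^{(k)} & \cdots & a_2^{(k)}\\ \vdots & \vdots & \ddots & \vdots\\ 0&0&\cdots & a_n^{(k)}\end{pmatrix}, \] whose \(i\)-th row is \(0\) before the diagonal and equal to \(a_i^{(k)}\) from the diagonal onward. Assume that every \(R_k\) is expanding (all its eigenvalues have modulus greater than \(1\)). For \(k\ge 1\) let \(D_k\subset\mathbb Z^n\) be a finite set with \(\#D_k=m\). Assume that \[ \limsup_{k\to\infty}\|R_k^{-1}\|<1\quad\text{and}\quad \sup\{\|d\|: d\in D_k,\ k\ge1\}<\infty, \] where \(\|d\|\) is the Euclidean norm and \(\|R_k^{-1}\|\) the corresponding operator norm. Write \(m_{D_k}(\xi)=\frac1{\#D_k}\sum_{d\in D_k}e^{2\pi i\langle \xi,d\rangle}\) for \(\xi\in\mathbb R^n\), and assume that for every \(k\ge1\)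 there is a vector \(\nu_k\in\mathbb Z^n\), all of whose coordinates lie in \(\{1,\dots,m-1\}\), such that \[ \{\xi\in\mathbb R^n: m_{D_k}(\xi)=0\}=\bigcup_{j=1}^{m-1}\Bigl(\frac jm\nu_k+\mathbb Z^n\Bigr). \] For a finite set \(F\subset\mathbb R^n\) put \(\delta_F=\frac1{\#F}\sum_{x\in F}\delta_x\), where \(\delta_x\) is the Dirac measure at \(x\). Then the Moran measure \[ \mu=\delta_{R_1^{-1}D_1}*\delta_{R_1^{-1}R_2^{-1}D_2}*\delta_{R_1^{-1}R_2^{-1}R_3^{-1}D_3}*\cdots \] exists (as the weak limit of the finite convolutions, a Borel probability measure on \(\mathbb R^n\)), and \(\mu\) is a spectral measure if and only if \(m\mid a_i^{(k)}\) for all \(k\ge2\) and all \(i\in\{1,\dots,n\}\). Here \(\mu\) is called a spectral measure if there is a countable set \(\Lambda\subset\mathbb R^n\) such that \(\{e^{-2\pi i\langle\lambda,x\rangle}:\lambda\in\Lambda\}\) is an orthonormal basis of \(L^2(\mu)\). -/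

import Mathlib

open MeasureTheory Filter Topology
open scoped ENNReal BoundedContinuousFunction

noncomputable section

namespace Moran

variable {n : ℕ}

/-- The Euclidean space `ℝⁿ`. -/
abbrev E (n : ℕ) : Type := EuclideanSpace ℝ (Fin n)

/-- An integer vector, seen as a point of `ℝⁿ`. -/
def toE (d : Fin n → ℤ) : E n := WithLp.toLp 2 (fun i => (d i : ℝ))

/-- An integer matrix is expanding if all its complex eigenvalues have modulus `> 1`. -/
def IsExpanding (R : Matrix (Fin n) (Fin n) ℤ) : Prop :=
  ∀ z ∈ spectrum ℂ (R.map (Int.cast : ℤ → ℂ)), 1 < ‖z‖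

/-- The inverse of an integer matrix, as a real matrix. -/
def realInv (R : Matrix (Fin n) (Fin n) ℤ) : Matrix (Fin n) (Fin n) ℝ :=
  (R.map (Int.cast : ℤ → ℝ))⁻¹

/-- The upper-triangular matrix whose row `i` is `0` before the diagonal and constantly `b i`
from the diagonal onward. -/
def rowMatrix (b : Fin n → ℤ) : Matrix (Fin n) (Fin n) ℤ :=
  Matrix.of fun i j => if i ≤ j then b i else 0

/-- `δ_F = (1 / #F) ∑_{a ∈ F} δ_a` for a finite set `F`. -/
def uniformDirac (F : Finset (E n)) : Measure (E n) :=
  (F.card : ℝ≥0∞)⁻¹ • ∑ a ∈ F, Measure.dirac a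

open Classical in
/-- The finite set `A D ⊂ ℝⁿ` for a real matrix `A` and a finite set `D ⊂ ℤⁿ`. -/
def imageSet (A : Matrix (Fin n) (Fin n) ℝ) (D : Finset (Fin n → ℤ)) : Finset (E n) :=
  D.image fun d => WithLp.toLp 2 (A.mulVec fun i => (d i : ℝ))

/-- `R₁⁻¹ R₂⁻¹ ⋯ R_k⁻¹` (the sequence is indexed from `1`; `R 0` is not used). -/
def invProd (R : ℕ → Matrix (Fin n) (Fin n) ℤ) : ℕ → Matrix (Fin n) (Fin n) ℝ
  | 0 => 1
  | k + 1 => invProd R k * realInv (R (k + 1))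

/-- The finite convolution `δ_{R₁⁻¹D₁} * δ_{R₁⁻¹R₂⁻¹D₂} * ⋯ * δ_{R₁⁻¹⋯R_k⁻¹D_k}`. -/
def partialMoran (R : ℕ → Matrix (Fin n) (Fin n) ℤ) (D : ℕ → Finset (Fin n → ℤ)) :
    ℕ → Measure (E n)
  | 0 => Measure.dirac 0
  | k + 1 => (partialMoran R D k).conv (uniformDirac (imageSet (invProd R (k + 1)) (D (k + 1))))

/-- `μ` is the Moran measure `δ_{R₁⁻¹D₁} * δ_{R₁⁻¹R₂⁻¹D₂} * ⋯`: the weak limit of the finite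
convolutions. (Weak limits are unique.) -/
def IsMoranMeasure (R : ℕ → Matrix (Fin n) (Fin n) ℤ) (D : ℕ → Finset (Fin n → ℤ))
    (μ : ProbabilityMeasure (E n)) : Prop :=
  ∀ f : E n →ᵇ ℝ,
    Tendsto (fun k => ∫ x, f x ∂(partialMoran R D k)) atTop (𝓝 (∫ x, f x ∂(μ : Measure (E n))))

/-- The mask polynomial `m_D(ξ) = (1 / #D) ∑_{d ∈ D} exp(2πi⟨ξ, d⟩)`. -/
def mask (D : Finset (Fin n → ℤ)) (ξ : E n) : ℂ :=
  (1 / (D.card : ℂ)) *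
    ∑ d ∈ D, Complex.exp (2 * Real.pi * Complex.I * ((inner ℝ ξ (toE d) : ℝ) : ℂ))

/-- The zero set of the mask polynomial. -/
def maskZeros (D : Finset (Fin n → ℤ)) : Set (E n) := {ξ | mask D ξ = 0}

/-- The set `⋃_{j=1}^{m-1} ((j/m) ν + ℤⁿ)`. -/
def zeroPiece (m : ℕ) (ν : Fin n → ℤ) : Set (E n) :=
  ⋃ j ∈ Set.Icc 1 (m - 1), {x | ∃ z : Fin n → ℤ, x = ((j : ℝ) / (m : ℝ)) • toE ν + toE z}

/-- The zero set of `m_D` is a disjoint union of `φ` sets `⋃_{j=1}^{m-1} ((j/m) ν_i + ℤⁿ)`, where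
all coordinates of every `ν_i` are integers in `[1, m-1]`. -/
def ZerosDecompose (m : ℕ) (D : Finset (Fin n → ℤ)) (φ : ℕ) : Prop :=
  ∃ ν : Fin φ → Fin n → ℤ,
    (∀ i l, 1 ≤ ν i l ∧ ν i l ≤ (m : ℤ) - 1) ∧
    Pairwise (fun i i' => Disjoint (zeroPiece m (ν i)) (zeroPiece m (ν i'))) ∧
    maskZeros D = ⋃ i, zeroPiece m (ν i)

/-- The exponential `x ↦ exp(-2πi⟨l, x⟩)`. -/
def expFun (l x : E n) : ℂ :=
  Complex.exp (-2 * Real.pi * Complex.I * ((inner ℝ l x : ℝ) : ℂ))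

lemma memLp_expFun (μ : Measure (E n)) [IsFiniteMeasure μ] (l : E n) :
    MemLp (expFun l) 2 μ := by
  refine MemLp.of_bound (C := 1) ?_ (ae_of_all _ fun x => ?_)
  · have h : Continuous (expFun l) := by
      unfold expFun
      fun_prop
    exact h.aestronglyMeasurable
  · have h : (-2 * Real.pi * Complex.I * ((inner ℝ l x : ℝ) : ℂ))
        = ((-2 * Real.pi * inner ℝ l x : ℝ) : ℂ) * Complex.I := by
      push_cast
      ring
    rw [expFun, h, Complex.norm_exp_ofReal_mul_I]

/-- The exponential `x ↦ exp(-2πi⟨l, x⟩)` as an element of `L²(μ)`. -/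
def expLp (μ : Measure (E n)) [IsFiniteMeasure μ] (l : E n) : Lp ℂ 2 μ :=
  (memLp_expFun μ l).toLp (expFun l)

/-- `μ` is a spectral measure: for some countable `Λ ⊂ ℝⁿ` the exponentials
`exp(-2πi⟨l, x⟩)`, `l ∈ Λ`, form an orthonormal (Hilbert) basis of `L²(μ)`. -/
def IsSpectral (μ : ProbabilityMeasure (E n)) : Prop :=
  ∃ Λ : Set (E n), Λ.Countable ∧
    ∃ b : HilbertBasis Λ ℂ (Lp ℂ 2 (μ : Measure (E n))), ∀ l : Λ, b l = expLp (μ : Measure (E n)) l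

end Moran

end

/-! Write `pull R k` for the transpose of R₁⁻¹⋯R_k⁻¹. The Fourier transform of μ is the infinite
product of `mask (D k) (pull R k ξ)`, and it vanishes exactly when some factor does, that is, when
`pull R k ξ` lies in (c/m)ν_k + ℤⁿ for some k ≥ 1 and 1 ≤ c ≤ m - 1.

Necessity is a count. Suppose Λ is a spectrum and μ = σ * τ, where σ collects finitely many factors,
N of them. In a generic direction σ has a lone extreme atom of mass m⁻ᴺ, so on a cap at that end μ
is m⁻ᴺ times a translate of τ. Parseval on the cap, compared with Bessel in L²(τ), shows that if Λ
is split into classes orthogonal for τ, then there are at least mᴺ classes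
(`le_card_of_hilbertBasis`, `IsInfConv.pow_card_le`). Let R_{q+2} be the first matrix that is not 0
mod m. Levels 1,…,q split Λ into m^q classes (`exists_classes`). At level p = q+1 a zero of level
p+d gives m-1 cosets of ℤⁿ, the multiples of R_{p+1}ᵀ⋯R_{p+d}ᵀν_{p+d}/m, which matter only if that
vector is not integral (d is active). Both d = 0 and d = 1 are active; the latter because
R_{p+1}ᵀν_{p+1} ≡ 0 would force R_{p+1} ≡ 0. With s ≥ 2 active shifts there are at most 1 + s(m-1) <
mˢ residues; with infinitely many, the mⁿ residues of (1/m)ℤⁿ/ℤⁿ are still fewer than m^(n+1).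
Within a refined class no zero comes from a removed factor, so the count is contradicted.

For sufficiency, adjoin at each level k the points whose pull is (c/m)ν_k mod ℤⁿ. Since R_k ≡ 0 mod
m for k ≥ 2, a new point is integral at all earlier levels, so orthogonality persists, and unitarity
of the digit exponentials makes the squared partial products sum to 1 over the k-th approximation
(`sum_partialSq`). Centred representatives keep the pulled points bounded, with first coordinate in
a region where every later mask is nonzero; hence the tails of the product are bounded below
(`exists_le_prod_tail`), and dominated convergence yields the Jorgensen–Pedersen identity. -/

noncomputable section

namespace Moran

variable {n : ℕ}

/-! ### Infinite convolutions of probability measures -/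

/-- The finite convolutions `δ₀ * ρ₀ * ⋯ * ρ_{k-1}`. -/
def partialConv (ρ : ℕ → Measure (E n)) : ℕ → Measure (E n)
  | 0 => Measure.dirac 0
  | k + 1 => (partialConv ρ k).conv (ρ k)

instance isProbabilityMeasure_partialConv (ρ : ℕ → Measure (E n))
    [∀ j, IsProbabilityMeasure (ρ j)] (k : ℕ) : IsProbabilityMeasure (partialConv ρ k) := by
  induction k with
  | zero => unfold partialConv; infer_instance
  | succ k ih => unfold partialConv; infer_instance

lemma charFun_partialConv (ρ : ℕ → Measure (E n)) [∀ j, IsProbabilityMeasure (ρ j)] (k : ℕ)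
    (t : E n) : charFun (partialConv ρ k) t = ∏ j ∈ Finset.range k, charFun (ρ j) t := by
  induction k with
  | zero => simp [partialConv, charFun_dirac]
  | succ k ih => rw [partialConv, charFun_conv, ih, Finset.prod_range_succ]

lemma ae_conv {μ ν : Measure (E n)} [SFinite μ] [SFinite ν] {p q r : E n → Prop}
    (hr : MeasurableSet {x | r x}) (hp : ∀ᵐ x ∂μ, p x) (hq : ∀ᵐ x ∂ν, q x)
    (h : ∀ x y, p x → q y → r (x + y)) : ∀ᵐ x ∂(μ.conv ν), r x := by
  rw [Measure.conv, ae_map_iff (by fun_prop) hr]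
  have h1 : ∀ᵐ z ∂μ.prod ν, p z.1 := Measure.quasiMeasurePreserving_fst.ae hp
  have h2 : ∀ᵐ z ∂μ.prod ν, q z.2 := Measure.quasiMeasurePreserving_snd.ae hq
  filter_upwards [h1, h2] with z hz1 hz2 using h _ _ hz1 hz2

lemma ae_norm_partialConv_le {ρ : ℕ → Measure (E n)} [∀ j, IsProbabilityMeasure (ρ j)]
    {c : ℕ → ℝ} (hρ : ∀ j, ∀ᵐ x ∂(ρ j), ‖x‖ ≤ c j) (k : ℕ) :
    ∀ᵐ x ∂(partialConv ρ k), ‖x‖ ≤ ∑ j ∈ Finset.range k, c j := by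
  induction k with
  | zero => simp [partialConv]
  | succ k ih =>
    refine ae_conv (measurableSet_le (by fun_prop) (by fun_prop)) ih (hρ k) fun x y hx hy => ?_
    rw [Finset.sum_range_succ]
    exact (norm_add_le x y).trans (add_le_add hx hy)

lemma norm_charFun_sub_one_le {ρ : Measure (E n)} [IsProbabilityMeasure ρ] {c : ℝ}
    (hρ : ∀ᵐ x ∂ρ, ‖x‖ ≤ c) (t : E n) : ‖charFun ρ t - 1‖ ≤ c * ‖t‖ := by
  have h1 : charFun ρ t - 1 = ∫ x, (Complex.exp ((inner ℝ x t : ℝ) * Complex.I) - 1) ∂ρ := by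
    rw [integral_sub _ (integrable_const _), charFun_apply]
    · simp
    · refine Integrable.of_bound (C := 1) (by fun_prop) (ae_of_all _ fun x => ?_)
      rw [Complex.norm_exp_ofReal_mul_I]
  rw [h1]
  have h2 : ∀ᵐ x ∂ρ, ‖Complex.exp ((inner ℝ x t : ℝ) * Complex.I) - 1‖ ≤ c * ‖t‖ := by
    filter_upwards [hρ] with x hx
    rw [mul_comm]
    refine (Real.norm_exp_I_mul_ofReal_sub_one_le).trans ?_
    exact (norm_inner_le_norm x t).trans (by gcongr)
  simpa using norm_integral_le_of_norm_le_const h2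

/-- An infinite convolution of probability measures with summable radii of support. -/
structure IsInfConv (ρ : ℕ → Measure (E n)) (μ : ProbabilityMeasure (E n)) : Prop where
  tendsto_integral (f : E n →ᵇ ℝ) :
    Tendsto (fun k => ∫ x, f x ∂(partialConv ρ k)) atTop (𝓝 (∫ x, f x ∂(μ : Measure (E n))))
  tendsto_prod (t : E n) :
    Tendsto (fun k => ∏ j ∈ Finset.range k, charFun (ρ j) t) atTop
      (𝓝 (charFun (μ : Measure (E n)) t))
  bounded : ∃ C, ∀ᵐ x ∂(μ : Measure (E n)), ‖x‖ ≤ C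

lemma summable_norm_charFun_sub_one {ρ : ℕ → Measure (E n)} [∀ j, IsProbabilityMeasure (ρ j)]
    {c : ℕ → ℝ} (hc : Summable c) (hρ : ∀ j, ∀ᵐ x ∂(ρ j), ‖x‖ ≤ c j) (t : E n) :
    Summable fun j => ‖charFun (ρ j) t - 1‖ :=
  Summable.of_nonneg_of_le (fun _ => norm_nonneg _)
    (fun j => norm_charFun_sub_one_le (hρ j) t) (hc.mul_right ‖t‖)

lemma tendsto_prod_charFun {ρ : ℕ → Measure (E n)} [∀ j, IsProbabilityMeasure (ρ j)]
    {c : ℕ → ℝ} (hc : Summable c) (hρ : ∀ j, ∀ᵐ x ∂(ρ j), ‖x‖ ≤ c j) (t : E n) :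
    Tendsto (fun k => ∏ j ∈ Finset.range k, charFun (ρ j) t) atTop
      (𝓝 (∏' j, charFun (ρ j) t)) := by
  have h := (multipliable_one_add_of_summable (summable_norm_charFun_sub_one hc hρ t)).hasProd
  simpa using h.tendsto_prod_nat

/-- All partial convolutions live on one closed ball, so they have a limit along an ultrafilter. Its
characteristic function must be the convergent infinite product, and Lévy's continuity theorem
upgrades this to weak convergence of the whole sequence. -/
lemma exists_isInfConv {ρ : ℕ → Measure (E n)} [∀ j, IsProbabilityMeasure (ρ j)]
    {c : ℕ → ℝ} (hc : Summable c) (hρ : ∀ j, ∀ᵐ x ∂(ρ j), ‖x‖ ≤ c j) :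
    ∃ μ : ProbabilityMeasure (E n), IsInfConv ρ μ := by
  have hc0 : ∀ j, 0 ≤ c j := fun j => by
    obtain ⟨x, hx⟩ := (hρ j).exists
    exact (norm_nonneg x).trans hx
  set C := ∑' j, c j
  let P : ℕ → ProbabilityMeasure (E n) := fun k => ⟨partialConv ρ k, inferInstance⟩
  let S : Set (ProbabilityMeasure (E n)) :=
    {μ | ∀ _ : ℕ, μ (Metric.closedBall 0 C)ᶜ ≤ (0 : NNReal)}
  have hS : IsCompact S :=
    isCompact_setOfPred_probabilityMeasure_mass_eq_compl_isCompact_le (u := fun _ => 0)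
      (K := fun _ => Metric.closedBall 0 C) tendsto_const_nhds
      (fun _ => isCompact_closedBall 0 C) (Or.inl inferInstance)
  have hmem : ∀ μ : ProbabilityMeasure (E n),
      μ ∈ S ↔ ∀ᵐ x ∂(μ : Measure (E n)), ‖x‖ ≤ C := fun μ => by
    have : {x : E n | ¬ ‖x‖ ≤ C} = (Metric.closedBall 0 C)ᶜ := by ext; simp
    rw [ae_iff, this]
    simp only [S, Set.mem_ofPred_eq, nonpos_iff_eq_zero, forall_const]
    exact ProbabilityMeasure.null_iff_toMeasure_null μ _
  have hP : ∀ k, P k ∈ S := fun k => by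
    rw [hmem]
    filter_upwards [ae_norm_partialConv_le hρ k] with x hx
    exact hx.trans (hc.sum_le_tsum _ fun j _ => hc0 j)
  have hPc : ∀ k t, charFun (P k : Measure (E n)) t = ∏ j ∈ Finset.range k, charFun (ρ j) t :=
    fun k t => charFun_partialConv ρ k t
  obtain ⟨μ, hμS, hμ⟩ := hS.ultrafilter_le_nhds ((hyperfilter ℕ).map P)
    (by
      rw [le_principal_iff, Ultrafilter.coe_map]
      exact Filter.mem_map.2 (Filter.univ_mem' hP))
  have hμ' : Tendsto P (hyperfilter ℕ : Filter ℕ) (𝓝 μ) := hμ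
  have hchar : ∀ t, Tendsto (fun k => charFun (P k : Measure (E n)) t) atTop
      (𝓝 (charFun (μ : Measure (E n)) t)) := fun t => by
    have h1 : Tendsto (fun k => charFun (P k : Measure (E n)) t) atTop
        (𝓝 (∏' j, charFun (ρ j) t)) := by
      simpa only [hPc] using tendsto_prod_charFun hc hρ t
    have h2 : Tendsto (fun k => charFun (P k : Measure (E n)) t) (hyperfilter ℕ : Filter ℕ)
        (𝓝 (charFun (μ : Measure (E n)) t)) := by
      rw [ProbabilityMeasure.tendsto_iff_forall_integral_rclike_tendsto ℂ] at hμ'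
      simp_rw [charFun_eq_integral_innerProbChar]
      exact hμ' _
    have h3 := tendsto_nhds_unique h2 (h1.mono_left Nat.hyperfilter_le_atTop)
    rwa [h3]
  refine ⟨μ, fun f => ?_, fun t => ?_, C, (hmem μ).1 hμS⟩
  · have := ProbabilityMeasure.tendsto_of_tendsto_charFun hchar
    exact (ProbabilityMeasure.tendsto_iff_forall_integral_tendsto.1 this) f
  · simpa only [hPc] using hchar t

/-- An infinite product whose factors differ from 1 by a summable amount vanishes only if a factor
does. -/
lemma IsInfConv.exists_charFun_eq_zero {ρ : ℕ → Measure (E n)} [∀ j, IsProbabilityMeasure (ρ j)]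
    {c : ℕ → ℝ} (hc : Summable c) (hρ : ∀ j, ∀ᵐ x ∂(ρ j), ‖x‖ ≤ c j)
    {μ : ProbabilityMeasure (E n)} (hμ : IsInfConv ρ μ) {t : E n}
    (ht : charFun (μ : Measure (E n)) t = 0) : ∃ j, charFun (ρ j) t = 0 := by
  by_contra! hne
  have h1 := tendsto_nhds_unique (hμ.tendsto_prod t) (tendsto_prod_charFun hc hρ t)
  refine tprod_one_add_ne_zero_of_summable (f := fun j => charFun (ρ j) t - 1) (by simpa using hne)
    (summable_norm_charFun_sub_one hc hρ t) ?_
  simpa [← h1] using ht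

lemma IsInfConv.charFun_eq_zero {ρ : ℕ → Measure (E n)}
    {μ : ProbabilityMeasure (E n)} (hμ : IsInfConv ρ μ) {t : E n} {j : ℕ}
    (ht : charFun (ρ j) t = 0) : charFun (μ : Measure (E n)) t = 0 := by
  refine tendsto_nhds_unique (hμ.tendsto_prod t) (tendsto_const_nhds.congr' ?_)
  filter_upwards [eventually_gt_atTop j] with k hk
  exact (Finset.prod_eq_zero (Finset.mem_range.2 hk) ht).symm

/-! ### Exponentials in L²(μ) and the criterion for completeness -/

/-- The Fourier transform `ξ ↦ ∫ exp(2πi⟨ξ, x⟩) dμ(x)`. -/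
def ft (μ : Measure (E n)) (ξ : E n) : ℂ := charFun μ ((2 * Real.pi) • ξ)

lemma continuous_expFun (l : E n) : Continuous (expFun l) := by
  unfold expFun
  fun_prop

lemma expFun_eq (l x : E n) :
    expFun l x = Complex.exp ((inner ℝ x (-((2 * Real.pi) • l)) : ℝ) * Complex.I) := by
  rw [expFun, inner_neg_right, inner_smul_right, real_inner_comm]
  congr 1
  push_cast
  ring

lemma norm_expFun (l x : E n) : ‖expFun l x‖ = 1 := by
  rw [expFun_eq, Complex.norm_exp_ofReal_mul_I]

lemma expFun_add (l x y : E n) : expFun l (x + y) = expFun l x * expFun l y := by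
  rw [expFun, expFun, expFun, ← Complex.exp_add, inner_add_right]
  congr 1
  push_cast
  ring

lemma inner_expLp (μ : Measure (E n)) [IsFiniteMeasure μ] (l l' : E n) :
    inner ℂ (expLp μ l) (expLp μ l') = ft μ (l - l') := by
  rw [L2.inner_def, ft, charFun_apply]
  refine integral_congr_ae ?_
  filter_upwards [(memLp_expFun μ l).coeFn_toLp, (memLp_expFun μ l').coeFn_toLp] with x h1 h2
  rw [expLp, expLp, h1, h2, RCLike.inner_apply, expFun_eq, expFun_eq, ← Complex.exp_conj,
    ← Complex.exp_add]
  congr 1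
  simp only [inner_neg_right, inner_smul_right, inner_sub_right, map_mul, Complex.conj_ofReal,
    Complex.conj_I]
  push_cast
  ring

lemma ft_zero (μ : Measure (E n)) [IsProbabilityMeasure μ] : ft μ 0 = 1 := by
  simp [ft]

lemma orthonormal_expLp (μ : Measure (E n)) [IsProbabilityMeasure μ] {ι : Type*} {f : ι → E n}
    (h : ∀ i j, i ≠ j → ft μ (f i - f j) = 0) : Orthonormal ℂ fun i => expLp μ (f i) := by
  classical
  rw [orthonormal_iff_ite]
  intro i j
  rw [inner_expLp]
  split_ifs with hij
  · rw [hij, sub_self, ft_zero]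
  · exact h i j hij

/-- The positive and negative parts of `g` are densities of finite measures with equal
characteristic functions, hence of the same measure. -/
lemma ae_eq_zero_of_integral_real {μ : Measure (E n)} [IsFiniteMeasure μ] {g : E n → ℝ}
    (hg : Integrable g μ)
    (h : ∀ t, ∫ x, (g x : ℂ) * Complex.exp ((inner ℝ x t : ℝ) * Complex.I) ∂μ = 0) :
    g =ᵐ[μ] 0 := by
  have key : ∀ {g : E n → ℝ}, Integrable g μ → ∀ t,
      charFun (μ.withDensity fun x => ENNReal.ofReal (g x)) t
        = ∫ x, ((max (g x) 0 : ℝ) : ℂ) * Complex.exp ((inner ℝ x t : ℝ) * Complex.I) ∂μ := by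
    intro g hg t
    rw [charFun_apply, integral_withDensity_eq_integral_toReal_smul₀
      hg.aemeasurable.ennreal_ofReal (ae_of_all _ fun x => ENNReal.ofReal_lt_top)]
    refine integral_congr_ae (ae_of_all _ fun x => ?_)
    simp only [ENNReal.toReal_ofReal', Complex.real_smul]
  have hint : ∀ {g : E n → ℝ}, Integrable g μ → ∀ t, Integrable (fun x =>
      ((max (g x) 0 : ℝ) : ℂ) * Complex.exp ((inner ℝ x t : ℝ) * Complex.I)) μ := by
    intro g hg t
    refine hg.pos_part.ofReal.mul_bdd (c := 1) (by fun_prop) (ae_of_all _ fun x => ?_)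
    rw [Complex.norm_exp_ofReal_mul_I]
  have h1 := isFiniteMeasure_withDensity_ofReal hg.2
  have h2 := isFiniteMeasure_withDensity_ofReal hg.neg.2
  have heq : (μ.withDensity fun x => ENNReal.ofReal (g x))
      = μ.withDensity fun x => ENNReal.ofReal ((-g) x) := by
    refine Measure.ext_of_charFun (funext fun t => ?_)
    rw [key hg, key hg.neg, ← sub_eq_zero, ← integral_sub (hint hg t) (hint hg.neg t), ← h t]
    refine integral_congr_ae (ae_of_all _ fun x => ?_)
    simp only [Pi.neg_apply]
    rw [← sub_mul, ← Complex.ofReal_sub]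
    congr 2
    rcases le_total (g x) 0 with hx | hx
    · rw [max_eq_right hx, max_eq_left (by linarith)]; ring
    · rw [max_eq_left hx, max_eq_right (by linarith)]; ring
  rw [withDensity_eq_iff hg.aemeasurable.ennreal_ofReal hg.neg.aemeasurable.ennreal_ofReal
    hg.lintegral_lt_top.ne] at heq
  filter_upwards [heq] with x hx
  have := congrArg ENNReal.toReal hx
  simp only [ENNReal.toReal_ofReal', Pi.neg_apply] at this
  simp only [Pi.zero_apply]
  rcases le_total (g x) 0 with hx | hx
  · rw [max_eq_right hx, max_eq_left (by linarith)] at this; linarith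
  · rw [max_eq_left hx, max_eq_right (by linarith)] at this; linarith

lemma ae_eq_zero_of_integral {μ : Measure (E n)} [IsFiniteMeasure μ] {g : E n → ℂ}
    (hg : Integrable g μ)
    (h : ∀ t, ∫ x, g x * Complex.exp ((inner ℝ x t : ℝ) * Complex.I) ∂μ = 0) :
    g =ᵐ[μ] 0 := by
  have hint : ∀ {f : E n → ℂ}, Integrable f μ → ∀ t, Integrable (fun x =>
      f x * Complex.exp ((inner ℝ x t : ℝ) * Complex.I)) μ := by
    intro f hf t
    refine hf.mul_bdd (c := 1) (by fun_prop) (ae_of_all _ fun x => ?_)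
    rw [Complex.norm_exp_ofReal_mul_I]
  have hconj : Integrable (fun x => (starRingEnd ℂ) (g x)) μ := by
    refine hg.norm.mono' (Complex.continuous_conj.comp_aestronglyMeasurable hg.1)
      (ae_of_all _ fun x => ?_)
    simp
  have h' : ∀ t, ∫ x, (starRingEnd ℂ) (g x) * Complex.exp ((inner ℝ x t : ℝ) * Complex.I) ∂μ
      = 0 := fun t => by
    have := congrArg (starRingEnd ℂ) (h (-t))
    rw [← integral_conj, map_zero] at this
    rw [← this]
    refine integral_congr_ae (ae_of_all _ fun x => ?_)
    simp only [map_mul, ← Complex.exp_conj, inner_neg_right, Complex.conj_ofReal, Complex.conj_I]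
    push_cast
    congr 2
    ring
  have hre : (fun x => (g x).re) =ᵐ[μ] 0 := by
    refine ae_eq_zero_of_integral_real hg.re fun t => ?_
    have : ∀ x, ((g x).re : ℂ) * Complex.exp ((inner ℝ x t : ℝ) * Complex.I)
        = (1 / 2 : ℂ) * (g x * Complex.exp ((inner ℝ x t : ℝ) * Complex.I)
          + (starRingEnd ℂ) (g x) * Complex.exp ((inner ℝ x t : ℝ) * Complex.I)) := fun x => by
      rw [← add_mul, Complex.add_conj]; push_cast; ring
    simp_rw [this]
    rw [integral_const_mul, integral_add (hint hg t) (hint hconj t), h, h']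
    simp
  have him : (fun x => (g x).im) =ᵐ[μ] 0 := by
    refine ae_eq_zero_of_integral_real hg.im fun t => ?_
    have : ∀ x, ((g x).im : ℂ) * Complex.exp ((inner ℝ x t : ℝ) * Complex.I)
        = (1 / (2 * Complex.I) : ℂ) * (g x * Complex.exp ((inner ℝ x t : ℝ) * Complex.I)
          - (starRingEnd ℂ) (g x) * Complex.exp ((inner ℝ x t : ℝ) * Complex.I)) := fun x => by
      rw [← sub_mul, Complex.sub_conj]
      field_simp
      push_cast
      ring
    simp_rw [this]
    rw [integral_const_mul, integral_sub (hint hg t) (hint hconj t), h, h']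
    simp
  filter_upwards [hre, him] with x h1 h2
  exact Complex.ext h1 h2

lemma eq_zero_of_inner_expLp (μ : Measure (E n)) [IsFiniteMeasure μ] {f : Lp ℂ 2 μ}
    (h : ∀ ξ, inner ℂ (expLp μ ξ) f = 0) : f = 0 := by
  rw [Lp.eq_zero_iff_ae_eq_zero]
  refine ae_eq_zero_of_integral ((Lp.memLp f).integrable (by norm_num)) fun t => ?_
  rw [← h ((2 * Real.pi)⁻¹ • t), L2.inner_def]
  refine integral_congr_ae ?_
  filter_upwards [(memLp_expFun μ ((2 * Real.pi)⁻¹ • t)).coeFn_toLp] with x h1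
  rw [expLp, h1, RCLike.inner_apply, expFun_eq, ← Complex.exp_conj, smul_smul,
    mul_inv_cancel₀ (by positivity), one_smul]
  simp

/-- Jorgensen–Pedersen criterion: an orthogonal family of exponentials is a basis if
`∑_{l ∈ Λ} |μ̂(ξ + l)|² = 1` for all `ξ`. -/
theorem isSpectral_of_hasSum (μ : ProbabilityMeasure (E n)) {Λ : Set (E n)} (hΛ : Λ.Countable)
    (horth : ∀ l ∈ Λ, ∀ l' ∈ Λ, l ≠ l' → ft (μ : Measure (E n)) (l - l') = 0)
    (hsum : ∀ ξ, HasSum (fun l : Λ => ‖ft (μ : Measure (E n)) (ξ + l)‖ ^ 2) 1) :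
    IsSpectral μ := by
  classical
  have hon : Orthonormal ℂ fun l : Λ => expLp (μ : Measure (E n)) l :=
    orthonormal_expLp _ fun i j hij => horth i i.2 j j.2 fun h => hij (Subtype.ext h)
  have hbot : (Submodule.span ℂ (Set.range fun l : Λ => expLp (μ : Measure (E n)) l))ᗮ = ⊥ := by
    rw [Submodule.eq_bot_iff]
    intro f hf
    by_contra hf0
    rw [Submodule.mem_orthogonal] at hf
    have hfl : ∀ l : Λ, inner ℂ (expLp (μ : Measure (E n)) l) f = 0 := fun l =>
      hf _ (Submodule.subset_span ⟨l, rfl⟩)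
    have hnf : (‖f‖ : ℂ) ≠ 0 := by simpa using hf0
    -- The normalised `f` is adjoined to the exponentials. In Bessel's inequality for `expLp μ ξ`
    -- the exponentials already use up the whole norm 1, so `f` is orthogonal to every `expLp μ ξ`.
    let e : Λ → Lp ℂ 2 (μ : Measure (E n)) := fun l => expLp (μ : Measure (E n)) l
    let v : Option Λ → Lp ℂ 2 (μ : Measure (E n)) := fun o => o.elim ((‖f‖ : ℂ)⁻¹ • f) e
    have hv : Orthonormal ℂ v := by
      rw [orthonormal_iff_ite]
      rintro (_ | i) (_ | j)
      · simp only [v, Option.elim, if_true]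
        rw [inner_self_eq_norm_sq_to_K, norm_smul]
        simp [hf0]
      · simp only [v, Option.elim, inner_smul_left, reduceCtorEq, if_false]
        rw [← inner_conj_symm, hfl j]; simp
      · simp only [v, Option.elim, inner_smul_right, reduceCtorEq, if_false]
        rw [hfl i]; simp
      · simpa [v] using (orthonormal_iff_ite.1 hon) i j
    refine hf0 (eq_zero_of_inner_expLp _ fun ξ => ?_)
    have hb : ∀ s : Finset Λ, ∑ l ∈ s, ‖ft (μ : Measure (E n)) (-ξ + l)‖ ^ 2
        ≤ 1 - ‖inner ℂ (v none) (expLp (μ : Measure (E n)) ξ)‖ ^ 2 := fun s => by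
      have h1 := hv.sum_inner_products_le (expLp (μ : Measure (E n)) ξ) (s := s.insertNone)
      rw [Finset.sum_insertNone] at h1
      have h2 : ‖expLp (μ : Measure (E n)) ξ‖ ^ 2 = 1 := by
        rw [← inner_self_eq_norm_sq (𝕜 := ℂ), inner_expLp, sub_self, ft_zero]; simp
      have h3 : ∀ l : Λ, ‖inner ℂ (v (some l)) (expLp (μ : Measure (E n)) ξ)‖
          = ‖ft (μ : Measure (E n)) (-ξ + l)‖ := fun l => by
        simp only [v, Option.elim, e]
        rw [inner_expLp, neg_add_eq_sub]
      rw [h2] at h1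
      simp only [h3] at h1
      linarith
    have h4 := hasSum_le_of_sum_le (hsum (-ξ)) hb
    have h5 : inner ℂ (v none) (expLp (μ : Measure (E n)) ξ) = 0 := by
      have : ‖inner ℂ (v none) (expLp (μ : Measure (E n)) ξ)‖ ^ 2 ≤ 0 := by linarith
      simpa using le_antisymm this (by positivity)
    simp only [v, Option.elim, inner_smul_left] at h5
    rw [← inner_conj_symm]
    rcases mul_eq_zero.1 h5 with h6 | h6
    · simp [hf0] at h6
    · rw [h6, map_zero]
  refine ⟨Λ, hΛ, HilbertBasis.mkOfOrthogonalEqBot hon hbot, fun l => ?_⟩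
  rw [HilbertBasis.coe_mkOfOrthogonalEqBot]

/-! ### Extreme atoms and a lower bound for the number of classes in a spectrum -/

/-- In the direction `u`, the measure `σ` has a lone extreme atom, of mass `1 / q`. -/
def HasPeak (u : E n) (q : ℕ) (σ : Measure (E n)) : Prop :=
  ∃ (s : E n) (ε : ℝ) (σ' : Measure (E n)), 0 < ε ∧ IsFiniteMeasure σ' ∧
    σ = (q : ℝ≥0∞)⁻¹ • Measure.dirac s + σ' ∧
    ∀ᵐ x ∂σ', inner ℝ u x ≤ inner ℝ u s - ε

lemma hasPeak_dirac_zero (u : E n) : HasPeak u 1 (Measure.dirac 0) :=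
  ⟨0, 1, 0, one_pos, inferInstance, by simp, by simp⟩

lemma isFiniteMeasure_inv_natCast_smul {q : ℕ} (hq : q ≠ 0) (ν : Measure (E n))
    [IsFiniteMeasure ν] : IsFiniteMeasure ((q : ℝ≥0∞)⁻¹ • ν) :=
  Measure.smul_finite _ (by simpa using hq)

lemma HasPeak.conv {u : E n} {q r : ℕ} (hq : q ≠ 0) (hr : r ≠ 0) {σ ρ : Measure (E n)}
    (hσ : HasPeak u q σ) (hρ : HasPeak u r ρ) : HasPeak u (q * r) (σ.conv ρ) := by
  obtain ⟨s, ε, σ', hε, hσ', rfl, hs⟩ := hσ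
  obtain ⟨t, δ, ρ', hδ, hρ', rfl, ht⟩ := hρ
  have i1 := isFiniteMeasure_inv_natCast_smul hq (Measure.dirac s)
  have i2 := isFiniteMeasure_inv_natCast_smul hr (Measure.dirac t)
  have hm : MeasurableSet {x : E n | inner ℝ u x ≤ inner ℝ u (s + t) - min ε δ} :=
    measurableSet_le (by fun_prop) (by fun_prop)
  have as : ∀ᵐ x ∂((q : ℝ≥0∞)⁻¹ • Measure.dirac s), inner ℝ u x ≤ inner ℝ u s :=
    Measure.ae_smul_measure (by simp) _
  have at' : ∀ᵐ x ∂((r : ℝ≥0∞)⁻¹ • Measure.dirac t), inner ℝ u x ≤ inner ℝ u t :=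
    Measure.ae_smul_measure (by simp) _
  refine ⟨s + t, min ε δ, ((q : ℝ≥0∞)⁻¹ • Measure.dirac s).conv ρ'
    + σ'.conv ((r : ℝ≥0∞)⁻¹ • Measure.dirac t + ρ'), lt_min hε hδ, inferInstance, ?_, ?_⟩
  · rw [Measure.add_conv, Measure.conv_add, ← add_assoc]
    congr 2
    rw [Measure.conv_smul_left, Measure.conv_smul_right, Measure.dirac_conv_dirac, smul_smul,
      Nat.cast_mul, ENNReal.mul_inv (by simp) (by simp)]
  · rw [ae_add_measure_iff]
    refine ⟨ae_conv hm as ht fun x y hx hy => ?_, ae_conv (q := fun x => inner ℝ u x ≤ inner ℝ u t)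
      hm hs ?_ fun x y hx hy => ?_⟩
    · rw [inner_add_right, inner_add_right]
      linarith [min_le_right ε δ]
    · rw [ae_add_measure_iff]
      exact ⟨at', ht.mono fun x hx => by linarith⟩
    · rw [inner_add_right, inner_add_right]
      linarith [min_le_left ε δ]

lemma hasPeak_uniformDirac {u : E n} {F : Finset (E n)} (hF : F.Nonempty)
    (hu : ∀ x ∈ F, ∀ y ∈ F, inner ℝ u x = inner ℝ u y → x = y) :
    HasPeak u F.card (uniformDirac F) := by
  classical
  obtain ⟨s, hs, hmax⟩ := F.exists_max_image (fun x => inner ℝ u x) hF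
  have hlt : ∀ x ∈ F.erase s, (inner ℝ u x : ℝ) < inner ℝ u s := fun x hx => by
    rw [Finset.mem_erase] at hx
    exact lt_of_le_of_ne (hmax x hx.2) fun h => hx.1 (hu x hx.2 s hs h)
  obtain ⟨ε, hε, hεle⟩ : ∃ ε > 0, ∀ x ∈ F.erase s, (inner ℝ u x : ℝ) ≤ inner ℝ u s - ε := by
    rcases (F.erase s).eq_empty_or_nonempty with h | h
    · exact ⟨1, one_pos, by simp [h]⟩
    · obtain ⟨y, hy, hym⟩ := (F.erase s).exists_max_image (fun x => inner ℝ u x) h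
      exact ⟨inner ℝ u s - inner ℝ u y, sub_pos.2 (hlt y hy), fun x hx => by
        have := hym x hx; linarith⟩
  refine ⟨s, ε, (F.card : ℝ≥0∞)⁻¹ • ∑ a ∈ F.erase s, Measure.dirac a, hε,
    isFiniteMeasure_inv_natCast_smul hF.card_pos.ne' _, ?_, Measure.ae_smul_measure ?_ _⟩
  · rw [uniformDirac, ← Finset.add_sum_erase F _ hs, smul_add]
  · have hm : MeasurableSet {x : E n | inner ℝ u x ≤ inner ℝ u s - ε} :=
      measurableSet_le (by fun_prop) (by fun_prop)
    rw [ae_iff, Measure.finsetSum_apply]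
    refine Finset.sum_eq_zero fun a ha => ?_
    rw [← ae_iff, ae_dirac_iff hm]
    exact hεle a ha

/-- Otherwise every upper bound for ⟨u, x⟩ could be lowered by `ε` again and again, contradicting
bounded support. -/
lemma exists_essential_max {τ : Measure (E n)} [IsProbabilityMeasure τ] {C : ℝ}
    (hτ : ∀ᵐ x ∂τ, ‖x‖ ≤ C) (u : E n) {ε : ℝ} (hε : 0 < ε) :
    ∃ M, (∀ᵐ x ∂τ, inner ℝ u x ≤ M) ∧ τ {x | M - ε < inner ℝ u x} ≠ 0 := by
  by_contra! h
  have h1 : ∀ k : ℕ, ∀ᵐ x ∂τ, inner ℝ u x ≤ ‖u‖ * C - k * ε := fun k => by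
    induction k with
    | zero =>
      filter_upwards [hτ] with x hx
      have := real_inner_le_norm u x
      have h2 : ‖u‖ * ‖x‖ ≤ ‖u‖ * C := by gcongr
      simp only [Nat.cast_zero, zero_mul, sub_zero]
      linarith
    | succ k ih =>
      have := h _ ih
      have hset : {x : E n | ¬ inner ℝ u x ≤ ‖u‖ * C - ((k + 1 : ℕ) : ℝ) * ε}
          = {x | ‖u‖ * C - k * ε - ε < inner ℝ u x} := by
        ext x
        simp only [Set.mem_ofPred_eq, not_le, Nat.cast_add, Nat.cast_one]
        constructor <;> intro h <;> linarith
      rw [ae_iff, hset, this]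
  obtain ⟨k, hk⟩ := exists_nat_gt (2 * (‖u‖ * C) / ε)
  rw [div_lt_iff₀ hε] at hk
  obtain ⟨x, hx1, hx2⟩ := ((h1 k).and hτ).exists
  have h3 := neg_le_of_abs_le (abs_real_inner_le_norm u x)
  have h2 : ‖u‖ * ‖x‖ ≤ ‖u‖ * C := by gcongr
  linarith

/-- If `μ = σ * τ` is spectral, `σ` has a lone extreme atom of mass `1 / q`, and the spectrum
splits into classes each of which is orthogonal for `τ`, then there are at least `q` classes. -/
theorem le_card_of_hilbertBasis {μ : ProbabilityMeasure (E n)} {σ τ : Measure (E n)}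
    [IsFiniteMeasure σ] [IsProbabilityMeasure τ] (hμ : (μ : Measure (E n)) = σ.conv τ)
    {C : ℝ} (hτ : ∀ᵐ x ∂τ, ‖x‖ ≤ C) {u : E n} {q : ℕ} (hq : q ≠ 0) (hσ : HasPeak u q σ)
    {Λ : Set (E n)} (b : HilbertBasis Λ ℂ (Lp ℂ 2 (μ : Measure (E n))))
    (hb : ∀ l : Λ, b l = expLp (μ : Measure (E n)) l) {α : Type*} [Fintype α] (κ : Λ → α)
    (hκ : ∀ l l', l ≠ l' → κ l = κ l' → ft τ (l - l') = 0) : q ≤ Fintype.card α := by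
  classical
  obtain ⟨s, ε, σ', hε, hσ', hσeq, hs⟩ := hσ
  obtain ⟨M, hM, hMpos⟩ := exists_essential_max hτ u hε
  have hqpos : (0 : ℝ) < q := by positivity
  let V : Set (E n) := {x | M - ε < inner ℝ u x}
  let U : Set (E n) := {x | inner ℝ u s + M - ε < inner ℝ u x}
  have hV : MeasurableSet V := measurableSet_lt (by fun_prop) (by fun_prop)
  have hU : MeasurableSet U := measurableSet_lt (by fun_prop) (by fun_prop)
  have i1 := isFiniteMeasure_inv_natCast_smul hq (Measure.dirac s)
  -- The rest `σ'` stays at least `ε` below the peak and `τ` stays below `M`, so `σ' * τ` misses the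
  -- cap `U`; only the peak at `s` contributes.
  have hμU : (μ : Measure (E n)).restrict U
      = (q : ℝ≥0∞)⁻¹ • (τ.restrict V).map (fun x => s + x) := by
    rw [hμ, hσeq, Measure.add_conv, Measure.restrict_add, Measure.conv_smul_left,
      Measure.dirac_conv]
    have h0 : (σ'.conv τ).restrict U = 0 := by
      rw [Measure.restrict_eq_zero]
      have := ae_conv (r := fun x => inner ℝ u x ≤ inner ℝ u s + M - ε)
        (measurableSet_le (by fun_prop) (by fun_prop)) hs hM fun x y hx hy => by
          rw [inner_add_right]; linarith
      rw [ae_iff] at this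
      simpa only [not_le] using this
    have hpre : (fun x => s + x) ⁻¹' U = V := by
      ext x
      simp only [U, V, Set.mem_preimage, Set.mem_ofPred_eq, inner_add_right]
      constructor <;> intro h <;> linarith
    rw [h0, add_zero, Measure.restrict_smul, Measure.restrict_map (by fun_prop) hU, hpre]
  have hint : ∀ l : E n, ∫ x in U, expFun l x ∂(μ : Measure (E n))
      = (q : ℂ)⁻¹ * (expFun l s * ∫ x in V, expFun l x ∂τ) := fun l => by
    rw [hμU, integral_smul_measure, integral_map (by fun_prop)
      (continuous_expFun l).aestronglyMeasurable]
    simp_rw [expFun_add]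
    rw [integral_const_mul, ENNReal.toReal_inv, ENNReal.toReal_natCast, Complex.real_smul]
    push_cast
    rfl
  have hμV : (μ : Measure (E n)).real U = (q : ℝ)⁻¹ * τ.real V := by
    have h1 : (μ : Measure (E n)) U = (q : ℝ≥0∞)⁻¹ * τ V := by
      rw [← Measure.restrict_apply_univ, hμU, Measure.smul_apply, Measure.map_apply (by fun_prop)
        MeasurableSet.univ]
      simp
    rw [Measure.real, h1, ENNReal.toReal_mul, ENNReal.toReal_inv, ENNReal.toReal_natCast]
    rfl
  have hVpos : 0 < τ.real V := ENNReal.toReal_pos hMpos (measure_ne_top _ _)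
  have hin : ∀ (ν : Measure (E n)) [IsProbabilityMeasure ν] (W : Set (E n)) (hW : MeasurableSet W)
      (l : E n), inner ℂ (indicatorConstLp 2 hW (measure_ne_top ν W) (1 : ℂ)) (expLp ν l)
        = ∫ x in W, expFun l x ∂ν := fun ν _ W hW l => by
    rw [L2.inner_indicatorConstLp_one]
    exact integral_congr_ae (ae_restrict_of_ae (memLp_expFun ν l).coeFn_toLp)
  have hnorm : ∀ (ν : Measure (E n)) [IsProbabilityMeasure ν] (W : Set (E n))
      (hW : MeasurableSet W),
      ‖indicatorConstLp 2 hW (measure_ne_top ν W) (1 : ℂ)‖ ^ 2 = ν.real W := fun ν _ W hW => by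
    rw [← inner_self_eq_norm_sq (𝕜 := ℂ), L2.inner_indicatorConstLp_one_indicatorConstLp_one]
    simp
  set f := indicatorConstLp 2 hU (measure_ne_top (μ : Measure (E n)) U) (1 : ℂ)
  set g := indicatorConstLp 2 hV (measure_ne_top τ V) (1 : ℂ)
  have hpars : HasSum (fun l : Λ => ‖inner ℂ f (expLp (μ : Measure (E n)) l)‖ ^ 2)
      ((μ : Measure (E n)).real U) := by
    have h1 := (b.hasSum_inner_mul_inner f f).mapL Complex.reCLM
    have h2 : Complex.reCLM (inner ℂ f f) = (μ : Measure (E n)).real U := by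
      rw [← hnorm _ U hU, ← inner_self_eq_norm_sq (𝕜 := ℂ)]; rfl
    rw [h2] at h1
    convert h1 using 2 with l
    rw [hb, ← inner_conj_symm f (expLp _ _), RCLike.norm_conj, Complex.reCLM_apply,
      ← Complex.normSq_eq_conj_mul_self, Complex.ofReal_re,
      Complex.normSq_eq_norm_sq]
  have hterm : ∀ l : E n, ‖inner ℂ f (expLp (μ : Measure (E n)) l)‖ ^ 2
      = (q : ℝ)⁻¹ ^ 2 * ‖inner ℂ (expLp τ l) g‖ ^ 2 := fun l => by
    rw [hin _ U hU, hint, norm_mul, norm_mul, norm_expFun, one_mul, mul_pow, norm_inv,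
      Complex.norm_natCast, ← hin _ V hV, norm_inner_symm]
  -- Each class is orthonormal in L²(τ), so Bessel bounds its share by τ(V). Against the Parseval
  -- total μ(U) = τ(V)/q, this gives q⁻¹ ≤ q⁻² · #α.
  have hbound : ∀ S : Finset Λ, ∑ l ∈ S, ‖inner ℂ f (expLp (μ : Measure (E n)) l)‖ ^ 2
      ≤ (q : ℝ)⁻¹ ^ 2 * (Fintype.card α * τ.real V) := fun S => by
    simp_rw [hterm]
    rw [← Finset.mul_sum, ← Finset.sum_fiberwise S κ]
    gcongr
    rw [← nsmul_eq_mul, ← Finset.card_univ]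
    refine Finset.sum_le_card_nsmul _ _ _ fun a _ => ?_
    have hon : Orthonormal ℂ fun l : {l : Λ // κ l = a} => expLp τ (l : E n) :=
      orthonormal_expLp τ fun i j hij =>
        hκ i j (fun h => hij (Subtype.ext h)) (i.2.trans j.2.symm)
    have h1 := hon.sum_inner_products_le g (s := S.subtype fun l => κ l = a)
    rw [hnorm _ V hV] at h1
    rw [Finset.sum_subtype_eq_sum_filter (f := fun l : Λ => ‖inner ℂ (expLp τ l) g‖ ^ 2)] at h1
    exact h1
  have hfin := hasSum_le_of_sum_le hpars hbound
  rw [hμV, sq, mul_assoc] at hfin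
  have h2 := le_of_mul_le_mul_left hfin (inv_pos.2 hqpos)
  rw [← mul_assoc] at h2
  rw [← one_mul (τ.real V), ← mul_assoc] at h2
  have h3 := le_of_mul_le_mul_right h2 hVpos
  rw [mul_one, inv_mul_eq_div, le_div_iff₀ hqpos, one_mul] at h3
  exact_mod_cast h3

/-! ### Integer vectors and mask polynomials -/

lemma toE_apply (z : Fin n → ℤ) (i : Fin n) : toE z i = z i := rfl

lemma toE_add (z w : Fin n → ℤ) : toE (z + w) = toE z + toE w := by
  ext i; simp [toE_apply]

lemma toE_neg (z : Fin n → ℤ) : toE (-z) = -toE z := by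
  ext i; simp [toE_apply]

lemma toE_zero : toE (0 : Fin n → ℤ) = 0 := by
  ext i; simp [toE_apply]

lemma toE_zsmul (c : ℤ) (z : Fin n → ℤ) : toE (c • z) = (c : ℝ) • toE z := by
  ext i; simp [toE_apply]

lemma toE_injective : Function.Injective (toE (n := n)) := fun z w h => by
  funext i
  have := congrArg (fun x : E n => x i) h
  simpa [toE_apply] using this

lemma inner_toE_toE (z d : Fin n → ℤ) : inner ℝ (toE z) (toE d) = ((∑ i, z i * d i : ℤ) : ℝ) := by
  simp [PiLp.inner_apply, toE_apply, mul_comm]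

/-- The integer lattice in `ℝⁿ`. -/
def intLattice (n : ℕ) : AddSubgroup (E n) where
  carrier := Set.range toE
  add_mem' := by rintro _ _ ⟨z, rfl⟩ ⟨w, rfl⟩; exact ⟨z + w, toE_add z w⟩
  zero_mem' := ⟨0, toE_zero⟩
  neg_mem' := by rintro _ ⟨z, rfl⟩; exact ⟨-z, toE_neg z⟩

lemma toE_mem (z : Fin n → ℤ) : toE z ∈ intLattice n := ⟨z, rfl⟩

/-- The exponential `exp(2πi⟨x, y⟩)`. -/
def e2 (x y : E n) : ℂ := Complex.exp (2 * Real.pi * Complex.I * ((inner ℝ x y : ℝ) : ℂ))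

lemma e2_add_left (x y z : E n) : e2 (x + y) z = e2 x z * e2 y z := by
  rw [e2, e2, e2, ← Complex.exp_add, inner_add_left]
  congr 1; push_cast; ring

lemma e2_zero_left (z : E n) : e2 0 z = 1 := by simp [e2]

lemma conj_e2 (x y : E n) : (starRingEnd ℂ) (e2 x y) = e2 (-x) y := by
  rw [e2, e2, ← Complex.exp_conj, inner_neg_left]
  congr 1
  simp only [map_mul, map_ofNat, Complex.conj_ofReal, Complex.conj_I]
  push_cast
  ring

lemma norm_e2 (x y : E n) : ‖e2 x y‖ = 1 := by
  rw [e2, show (2 * Real.pi * Complex.I * ((inner ℝ x y : ℝ) : ℂ))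
    = ((2 * Real.pi * inner ℝ x y : ℝ) : ℂ) * Complex.I by push_cast; ring,
    Complex.norm_exp_ofReal_mul_I]

lemma norm_e2_sub_one_le (x y : E n) : ‖e2 x y - 1‖ ≤ 2 * Real.pi * |inner ℝ x y| := by
  rw [e2, show (2 * Real.pi * Complex.I * ((inner ℝ x y : ℝ) : ℂ))
    = Complex.I * ((2 * Real.pi * inner ℝ x y : ℝ) : ℂ) by push_cast; ring]
  refine Real.norm_exp_I_mul_ofReal_sub_one_le.trans ?_
  rw [norm_mul, Real.norm_of_nonneg (by positivity), Real.norm_eq_abs]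

lemma e2_toE_toE (z d : Fin n → ℤ) : e2 (toE z) (toE d) = 1 := by
  rw [e2, inner_toE_toE, Complex.exp_eq_one_iff]
  exact ⟨∑ i, z i * d i, by push_cast; ring⟩

lemma mask_eq (D : Finset (Fin n → ℤ)) (x : E n) :
    mask D x = (D.card : ℂ)⁻¹ * ∑ d ∈ D, e2 x (toE d) := by
  rw [mask, one_div]; rfl

lemma mask_add_of_mem (D : Finset (Fin n → ℤ)) (x : E n) {y : E n} (hy : y ∈ intLattice n) :
    mask D (x + y) = mask D x := by
  obtain ⟨z, rfl⟩ := hy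
  simp_rw [mask_eq, e2_add_left, e2_toE_toE, mul_one]

lemma mask_zero {D : Finset (Fin n → ℤ)} (hD : D.card ≠ 0) : mask D 0 = 1 := by
  rw [mask_eq]
  simp [e2_zero_left, hD]

lemma continuous_mask (D : Finset (Fin n → ℤ)) : Continuous (mask D) := by
  unfold mask
  fun_prop

lemma norm_mask_sub_one_le {D : Finset (Fin n → ℤ)} (hD : D.card ≠ 0) (x : E n) {C : ℝ}
    (h : ∀ d ∈ D, |inner ℝ x (toE d)| ≤ C) : ‖mask D x - 1‖ ≤ 2 * Real.pi * C := by
  have hD' : (D.card : ℝ) ≠ 0 := by exact_mod_cast hD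
  have h1 : mask D x - 1 = (D.card : ℂ)⁻¹ * ∑ d ∈ D, (e2 x (toE d) - 1) := by
    rw [mask_eq, Finset.sum_sub_distrib, mul_sub]
    simp [hD]
  rw [h1, norm_mul, norm_inv, Complex.norm_natCast]
  calc (D.card : ℝ)⁻¹ * ‖∑ d ∈ D, (e2 x (toE d) - 1)‖
      ≤ (D.card : ℝ)⁻¹ * ∑ d ∈ D, 2 * Real.pi * C := by
        gcongr
        refine norm_sum_le_of_le _ fun d hd => (norm_e2_sub_one_le _ _).trans ?_
        gcongr
        exact h d hd
    _ = 2 * Real.pi * C := by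
        rw [Finset.sum_const, nsmul_eq_mul, inv_mul_cancel_left₀ hD']

/-! ### Transposed action of the matrices -/

/-- The action of `Aᵀ` on `ℝⁿ`. -/
def act (A : Matrix (Fin n) (Fin n) ℤ) : E n →ₗ[ℝ] E n :=
  Matrix.toLpLin 2 2 (A.map (Int.cast : ℤ → ℝ)).transpose

/-- The action of `(R₁⁻¹ ⋯ R_k⁻¹)ᵀ` on `ℝⁿ`. -/
def pull (R : ℕ → Matrix (Fin n) (Fin n) ℤ) (k : ℕ) : E n →ₗ[ℝ] E n :=
  Matrix.toLpLin 2 2 (invProd R k).transpose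

lemma act_apply (A : Matrix (Fin n) (Fin n) ℤ) (x : E n) (i : Fin n) :
    act A x i = ∑ l, (A l i : ℝ) * x l := by
  simp [act, Matrix.mulVec, dotProduct]

lemma act_toE (A : Matrix (Fin n) (Fin n) ℤ) (z : Fin n → ℤ) :
    act A (toE z) = toE (A.transpose.mulVec z) := by
  ext i
  simp [act_apply, toE_apply, Matrix.mulVec, dotProduct]

lemma act_mem (A : Matrix (Fin n) (Fin n) ℤ) {x : E n} (hx : x ∈ intLattice n) :
    act A x ∈ intLattice n := by
  obtain ⟨z, rfl⟩ := hx
  exact ⟨_, (act_toE A z).symm⟩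

lemma act_mem_of_dvd {A : Matrix (Fin n) (Fin n) ℤ} {m : ℕ} (hA : ∀ i j, (m : ℤ) ∣ A i j) {x : E n}
    (hx : (m : ℝ) • x ∈ intLattice n) : act A x ∈ intLattice n := by
  obtain ⟨z, hz⟩ := hx
  choose B hB using hA
  have : act A x = act (Matrix.of B) ((m : ℝ) • x) := by
    ext i
    simp only [act_apply, PiLp.smul_apply, smul_eq_mul, Matrix.of_apply, hB]
    exact Finset.sum_congr rfl fun l _ => by push_cast; ring
  rw [this]
  exact act_mem _ ⟨z, hz⟩

lemma pull_zero (R : ℕ → Matrix (Fin n) (Fin n) ℤ) (x : E n) : pull R 0 x = x := by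
  simp [pull, invProd]

lemma det_map_intCast (A : Matrix (Fin n) (Fin n) ℤ) :
    (A.map (Int.cast : ℤ → ℝ)).det = (A.det : ℝ) :=
  ((Int.castRingHom ℝ).map_det A).symm

lemma act_pull {R : ℕ → Matrix (Fin n) (Fin n) ℤ} {k : ℕ} (h : (R (k + 1)).det ≠ 0) (x : E n) :
    act (R (k + 1)) (pull R (k + 1) x) = pull R k x := by
  have h1 : IsUnit ((R (k + 1)).map (Int.cast : ℤ → ℝ)).det := by
    rw [det_map_intCast]
    simpa using h
  rw [act, pull, pull, ← LinearMap.comp_apply, ← Matrix.toLpLin_mul, invProd, realInv,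
    ← Matrix.transpose_mul, Matrix.mul_assoc, Matrix.nonsing_inv_mul _ h1, Matrix.mul_one]

lemma act_injective {A : Matrix (Fin n) (Fin n) ℤ} (h : A.det ≠ 0) : Function.Injective (act A) := by
  have h1 : IsUnit (A.map (Int.cast : ℤ → ℝ)).transpose.det := by
    rw [Matrix.det_transpose, det_map_intCast]
    simpa using h
  rw [injective_iff_map_eq_zero]
  intro x hx
  have h2 := congrArg (Matrix.toLpLin 2 2 (A.map (Int.cast : ℤ → ℝ)).transpose⁻¹) hx
  rw [act, ← LinearMap.comp_apply, ← Matrix.toLpLin_mul, Matrix.nonsing_inv_mul _ h1] at h2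
  simpa using h2

lemma pull_surjective {R : ℕ → Matrix (Fin n) (Fin n) ℤ} (hR : ∀ k, 1 ≤ k → (R k).det ≠ 0) (k : ℕ) :
    Function.Surjective (pull R k) := by
  induction k with
  | zero => exact fun x => ⟨x, pull_zero R x⟩
  | succ k ih =>
    intro y
    obtain ⟨x, hx⟩ := ih (act (R (k + 1)) y)
    refine ⟨x, act_injective (hR (k + 1) (by omega)) ?_⟩
    rw [act_pull (hR _ (by omega)), hx]

lemma pull_injective {R : ℕ → Matrix (Fin n) (Fin n) ℤ} (hR : ∀ k, 1 ≤ k → (R k).det ≠ 0) (k : ℕ) :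
    Function.Injective (pull R k) :=
  LinearMap.injective_iff_surjective.2 (pull_surjective hR k)

lemma inner_invProd (R : ℕ → Matrix (Fin n) (Fin n) ℤ) (k : ℕ) (x : E n) (d : Fin n → ℤ) :
    inner ℝ x (WithLp.toLp 2 ((invProd R k).mulVec fun i => (d i : ℝ)) : E n)
      = inner ℝ (pull R k x) (toE d) := by
  simp only [pull, Matrix.toLpLin_apply, EuclideanSpace.inner_eq_star_dotProduct, toE]
  simp only [star_trivial]
  rw [Matrix.mulVec_transpose, dotProduct_comm, Matrix.dotProduct_mulVec, dotProduct_comm]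

/-! ### The factors of the Moran measure -/

/-- The sequence of uniform measures whose infinite convolution is the Moran measure. -/
def factor (R : ℕ → Matrix (Fin n) (Fin n) ℤ) (D : ℕ → Finset (Fin n → ℤ)) (j : ℕ) :
    Measure (E n) :=
  uniformDirac (imageSet (invProd R (j + 1)) (D (j + 1)))

lemma partialMoran_eq (R : ℕ → Matrix (Fin n) (Fin n) ℤ) (D : ℕ → Finset (Fin n → ℤ)) (k : ℕ) :
    partialMoran R D k = partialConv (factor R D) k := by
  induction k with
  | zero => rfl
  | succ k ih => rw [partialMoran, partialConv, ih]; rfl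

lemma isProbabilityMeasure_uniformDirac {F : Finset (E n)} (hF : F.Nonempty) :
    IsProbabilityMeasure (uniformDirac F) := by
  constructor
  rw [uniformDirac, Measure.smul_apply, Measure.finsetSum_apply]
  simp only [measure_univ, Finset.sum_const, smul_eq_mul, nsmul_eq_mul, mul_one]
  exact ENNReal.inv_mul_cancel (by simpa using hF.ne_empty) (by simp)

lemma ae_uniformDirac {F : Finset (E n)} {p : E n → Prop} (hp : MeasurableSet {x | p x})
    (h : ∀ x ∈ F, p x) : ∀ᵐ x ∂(uniformDirac F), p x := by
  refine Measure.ae_smul_measure ?_ _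
  rw [ae_iff, Measure.finsetSum_apply]
  refine Finset.sum_eq_zero fun a ha => ?_
  rw [← ae_iff, ae_dirac_iff hp]
  exact h a ha

lemma charFun_uniformDirac (F : Finset (E n)) (t : E n) :
    charFun (uniformDirac F) t
      = (F.card : ℂ)⁻¹ * ∑ x ∈ F, Complex.exp ((inner ℝ x t : ℝ) * Complex.I) := by
  rw [charFun_apply, uniformDirac, integral_smul_measure, integral_finsetSum_measure]
  · simp [integral_dirac]
  · intro a _
    exact Integrable.of_bound (C := 1) (by fun_prop) (ae_of_all _ fun x => by
      rw [Complex.norm_exp_ofReal_mul_I])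

lemma invProd_injective {R : ℕ → Matrix (Fin n) (Fin n) ℤ} (hR : ∀ k, 1 ≤ k → (R k).det ≠ 0)
    (k : ℕ) : Function.Injective fun d : Fin n → ℤ =>
      (WithLp.toLp 2 ((invProd R k).mulVec fun i => (d i : ℝ)) : E n) := by
  intro d d' h
  refine toE_injective (ext_inner_left ℝ fun y => ?_)
  obtain ⟨x, rfl⟩ := pull_surjective hR k y
  rw [← inner_invProd, ← inner_invProd]
  exact congrArg (inner ℝ x) h

lemma card_imageSet {R : ℕ → Matrix (Fin n) (Fin n) ℤ} (hR : ∀ k, 1 ≤ k → (R k).det ≠ 0)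
    (k : ℕ) (D : Finset (Fin n → ℤ)) : (imageSet (invProd R k) D).card = D.card :=
  Finset.card_image_of_injective _ (invProd_injective hR k)

lemma ft_factor {R : ℕ → Matrix (Fin n) (Fin n) ℤ} (hR : ∀ k, 1 ≤ k → (R k).det ≠ 0)
    (D : ℕ → Finset (Fin n → ℤ)) (j : ℕ) (x : E n) :
    ft (factor R D j) x = mask (D (j + 1)) (pull R (j + 1) x) := by
  rw [ft, factor, charFun_uniformDirac, card_imageSet hR, imageSet,
    Finset.sum_image ((invProd_injective hR (j + 1)).injOn), mask_eq]
  congr 1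
  refine Finset.sum_congr rfl fun d _ => ?_
  rw [e2, ← inner_invProd, inner_smul_right, real_inner_comm]
  congr 1
  push_cast
  ring

lemma summable_norm_invProd {R : ℕ → Matrix (Fin n) (Fin n) ℤ}
    (hlim : limsup
      (fun k => ‖Matrix.toEuclideanCLM (n := Fin n) (𝕜 := ℝ) (realInv (R k))‖ₑ) atTop < 1) :
    Summable fun k => ‖Matrix.toEuclideanCLM (n := Fin n) (𝕜 := ℝ) (invProd R k)‖ := by
  obtain ⟨r, hr1, hr2⟩ := exists_between hlim
  have hr : r.toReal < 1 := by
    have := (ENNReal.toReal_lt_toReal (hr2.trans ENNReal.one_lt_top).ne ENNReal.one_ne_top).2 hr2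
    simpa using this
  have hev := eventually_lt_of_limsup_lt hr1
  refine summable_of_ratio_norm_eventually_le hr ?_
  filter_upwards [(tendsto_add_atTop_nat 1).eventually hev] with k hk
  rw [norm_norm, norm_norm, invProd, map_mul]
  refine (norm_mul_le _ _).trans ?_
  rw [mul_comm]
  gcongr
  rw [← toReal_enorm]
  exact ENNReal.toReal_mono (hr2.trans ENNReal.one_lt_top).ne hk.le

lemma ae_norm_factor_le (R : ℕ → Matrix (Fin n) (Fin n) ℤ) {D : ℕ → Finset (Fin n → ℤ)} {C : ℝ}
    (hD : ∀ k, 1 ≤ k → ∀ d ∈ D k, ‖toE d‖ ≤ C) (j : ℕ) :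
    ∀ᵐ x ∂(factor R D j),
      ‖x‖ ≤ ‖Matrix.toEuclideanCLM (n := Fin n) (𝕜 := ℝ) (invProd R (j + 1))‖ * C := by
  refine ae_uniformDirac (measurableSet_le (by fun_prop) (by fun_prop)) fun x hx => ?_
  simp only [imageSet, Finset.mem_image] at hx
  obtain ⟨d, hd, rfl⟩ := hx
  have h := (Matrix.toEuclideanCLM (n := Fin n) (𝕜 := ℝ) (invProd R (j + 1))).le_opNorm (toE d)
  rw [toE, Matrix.toEuclideanCLM_toLp] at h
  refine h.trans ?_
  gcongr
  exact hD (j + 1) (by omega) d hd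

/-! ### The counting bound for infinite convolutions -/

lemma exists_inner_injOn (T : Finset (E n)) :
    ∃ u : E n, ∀ x ∈ T, ∀ y ∈ T, inner ℝ u x = inner ℝ u y → x = y := by
  classical
  -- Some functional is nonzero on each of the finitely many nonzero differences.
  obtain ⟨f, hf⟩ := Module.exists_dual_forall_apply_ne_zero (K := ℝ)
    (fun p : {p : E n × E n // p ∈ (T ×ˢ T).filter fun p => p.1 ≠ p.2} => p.1.1 - p.1.2) fun p => sub_ne_zero.2 (Finset.mem_filter.1 p.2).2
  refine ⟨(InnerProductSpace.toDual ℝ (E n)).symm (LinearMap.toContinuousLinearMap f),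
    fun x hx y hy h => ?_⟩
  by_contra hxy
  refine hf ⟨(x, y), by simp [hx, hy, hxy]⟩ ?_
  rw [InnerProductSpace.toDual_symm_apply, InnerProductSpace.toDual_symm_apply] at h
  simpa [sub_eq_zero] using h

lemma hasPeak_partialConv {u : E n} {ρ : ℕ → Measure (E n)} {q : ℕ → ℕ} (hq : ∀ j, q j ≠ 0)
    (h : ∀ j, HasPeak u (q j) (ρ j)) (k : ℕ) :
    HasPeak u (∏ j ∈ Finset.range k, q j) (partialConv ρ k) := by
  induction k with
  | zero => exact hasPeak_dirac_zero u
  | succ k ih =>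
    rw [Finset.prod_range_succ]
    exact HasPeak.conv (Finset.prod_ne_zero_iff.2 fun j _ => hq j) (hq k) ih (h k)

/-- If the spectrum of an infinite convolution of uniform measures splits into classes whose
differences are never zeros of the factors in `J`, then there are at least `m ^ #J` classes. -/
theorem IsInfConv.pow_card_le {F : ℕ → Finset (E n)} (hF : ∀ j, (F j).Nonempty) {c : ℕ → ℝ}
    (hc : Summable c) (hFc : ∀ j, ∀ᵐ x ∂(uniformDirac (F j)), ‖x‖ ≤ c j)
    {μ : ProbabilityMeasure (E n)} (hμ : IsInfConv (fun j => uniformDirac (F j)) μ)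
    {Λ : Set (E n)} (b : HilbertBasis Λ ℂ (Lp ℂ 2 (μ : Measure (E n))))
    (hb : ∀ l : Λ, b l = expLp (μ : Measure (E n)) l) {m : ℕ} {J : Finset ℕ}
    (hJ : ∀ j ∈ J, (F j).card = m) {α : Type*} [Fintype α] (κ : Λ → α)
    (hκ : ∀ l l', l ≠ l' → κ l = κ l' → ∃ j, j ∉ J ∧ ft (uniformDirac (F j)) (l - l') = 0) :
    m ^ J.card ≤ Fintype.card α := by
  classical
  have hprob : ∀ j, IsProbabilityMeasure (uniformDirac (F j)) := fun j =>
    isProbabilityMeasure_uniformDirac (hF j)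
  have hc0 : ∀ j, 0 ≤ c j := fun j => by
    obtain ⟨x, hx⟩ := (hFc j).exists
    exact (norm_nonneg x).trans hx
  -- The factors are separated into those in `J` and the others, with the neutral measure δ₀ holding
  -- the vacant places; thus μ is the finite convolution of `ρ₁` convolved with the infinite one of
  -- `ρ₂`.
  let ρ₁ : ℕ → Measure (E n) := fun j => if j ∈ J then uniformDirac (F j) else Measure.dirac 0
  let ρ₂ : ℕ → Measure (E n) := fun j => if j ∈ J then Measure.dirac 0 else uniformDirac (F j)
  have hp1 : ∀ j, IsProbabilityMeasure (ρ₁ j) := fun j => by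
    simp only [ρ₁]; split_ifs <;> infer_instance
  have hp2 : ∀ j, IsProbabilityMeasure (ρ₂ j) := fun j => by
    simp only [ρ₂]; split_ifs <;> infer_instance
  have hρ₂ : ∀ j, ∀ᵐ x ∂(ρ₂ j), ‖x‖ ≤ c j := fun j => by
    simp only [ρ₂]
    split_ifs
    · simpa using hc0 j
    · exact hFc j
  obtain ⟨τ, hτ⟩ := exists_isInfConv hc hρ₂
  obtain ⟨C, hC⟩ := hτ.bounded
  obtain ⟨u, hu⟩ := exists_inner_injOn (J.biUnion F)
  set K := J.sup id + 1
  have hJK : ∀ j ∈ J, j < K := fun j hj => Nat.lt_succ_of_le (Finset.le_sup (f := id) hj)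
  have hsub : J ⊆ Finset.range K := fun j hj => Finset.mem_range.2 (hJK j hj)
  have hpeak : HasPeak u (m ^ J.card) (partialConv ρ₁ K) := by
    have h := hasPeak_partialConv (u := u) (ρ := ρ₁) (q := fun j => if j ∈ J then m else 1)
      (fun j => ?_) (fun j => ?_) K
    · rwa [Finset.prod_ite_mem, Finset.inter_eq_right.2 hsub, Finset.prod_const] at h
    · split_ifs with hj
      · exact hJ j hj ▸ (hF j).card_pos.ne'
      · exact one_ne_zero
    · simp only [ρ₁]
      split_ifs with hj
      · rw [← hJ j hj]
        exact hasPeak_uniformDirac (hF j) fun x hx y hy =>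
          hu x (Finset.mem_biUnion.2 ⟨j, hj, hx⟩) y (Finset.mem_biUnion.2 ⟨j, hj, hy⟩)
      · exact hasPeak_dirac_zero u
  have hm : m ^ J.card ≠ 0 := by
    rcases J.eq_empty_or_nonempty with rfl | ⟨j, hj⟩
    · simp
    · exact pow_ne_zero _ (hJ j hj ▸ (hF j).card_pos.ne')
  have hconv : (μ : Measure (E n)) = (partialConv ρ₁ K).conv τ := by
    refine Measure.ext_of_charFun (funext fun t => ?_)
    rw [charFun_conv, charFun_partialConv]
    refine tendsto_nhds_unique (hμ.tendsto_prod t)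
      (((hτ.tendsto_prod t).const_mul _).congr' ?_)
    filter_upwards [eventually_ge_atTop K] with k hk
    have h1 : ∏ j ∈ Finset.range K, charFun (ρ₁ j) t = ∏ j ∈ Finset.range k, charFun (ρ₁ j) t := by
      refine Finset.prod_subset (Finset.range_mono hk) fun j _ hj => ?_
      have : j ∉ J := fun h => hj (hsub h)
      simp [ρ₁, this, charFun_dirac]
    rw [h1, ← Finset.prod_mul_distrib]
    refine Finset.prod_congr rfl fun j _ => ?_
    by_cases hj : j ∈ J <;> simp [ρ₁, ρ₂, hj, charFun_dirac]
  refine le_card_of_hilbertBasis hconv hC hm hpeak b hb κ fun l l' hl hll => ?_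
  obtain ⟨j, hj, h0⟩ := hκ l l' hl hll
  refine hτ.charFun_eq_zero (j := j) ?_
  simpa only [ρ₂, hj, if_false, ft] using h0

/-! ### Digit data and the zeros seen from a lower level -/

/-- Invertible integer matrices `R k` and digit sets `D k` of prime cardinality `m` whose mask
polynomial vanishes exactly on the cosets `(c/m) ν + ℤⁿ`, `1 ≤ c ≤ m - 1`. -/
structure MoranData (m : ℕ) (R : ℕ → Matrix (Fin n) (Fin n) ℤ) (D : ℕ → Finset (Fin n → ℤ))
    (ν : ℕ → Fin n → ℤ) : Prop where
  prime : m.Prime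
  det_ne : ∀ k, 1 ≤ k → (R k).det ≠ 0
  card : ∀ k, 1 ≤ k → (D k).card = m
  ν_mem : ∀ k, 1 ≤ k → ∀ i, 1 ≤ ν k i ∧ ν k i ≤ (m : ℤ) - 1
  mask_eq_zero : ∀ k, 1 ≤ k → ∀ x, mask (D k) x = 0 ↔
    ∃ c : ℕ, (1 ≤ c ∧ c ≤ m - 1) ∧ ∃ z, x = ((c : ℝ) / (m : ℝ)) • toE (ν k) + toE z

lemma frac_mem_iff {m : ℕ} (hm : m ≠ 0) (c : ℕ) (v : Fin n → ℤ) :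
    ((c : ℝ) / (m : ℝ)) • toE v ∈ intLattice n ↔ ∀ i, (m : ℤ) ∣ c * v i := by
  have hm' : (m : ℝ) ≠ 0 := by exact_mod_cast hm
  constructor
  · rintro ⟨z, hz⟩ i
    have h := congrArg (fun x : E n => x i) hz
    simp only [toE_apply, PiLp.smul_apply, smul_eq_mul] at h
    refine ⟨z i, ?_⟩
    rw [div_mul_eq_mul_div, eq_div_iff hm'] at h
    have h' : z i * (m : ℤ) = c * v i := by exact_mod_cast h
    rw [← h', mul_comm]
  · intro h
    choose z hz using h
    refine ⟨z, ?_⟩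
    ext i
    simp only [toE_apply, PiLp.smul_apply, smul_eq_mul]
    rw [div_mul_eq_mul_div, eq_div_iff hm']
    have := hz i
    rw [mul_comm]
    exact_mod_cast this.symm

lemma not_dvd_mul {m : ℕ} (hm : m.Prime) {c : ℕ} (hc : 1 ≤ c ∧ c ≤ m - 1) {v : ℤ}
    (hv : ¬ (m : ℤ) ∣ v) : ¬ (m : ℤ) ∣ c * v := by
  intro h
  rcases (Nat.prime_iff_prime_int.1 hm).dvd_or_dvd h with h | h
  · have h1 := Nat.le_of_dvd (by omega) (Int.natCast_dvd_natCast.1 h)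
    have := hm.two_le
    omega
  · exact hv h

/-- `R_{p+1}ᵀ ⋯ R_{p+d}ᵀ v`. -/
def tr (R : ℕ → Matrix (Fin n) (Fin n) ℤ) : ℕ → ℕ → (Fin n → ℤ) → Fin n → ℤ
  | _, 0, v => v
  | p, d + 1, v => (R (p + 1)).transpose.mulVec (tr R (p + 1) d v)

namespace MoranData

variable {m : ℕ} {R : ℕ → Matrix (Fin n) (Fin n) ℤ} {D : ℕ → Finset (Fin n → ℤ)}
  {ν : ℕ → Fin n → ℤ}

lemma not_dvd_ν (h : MoranData m R D ν) {k : ℕ} (hk : 1 ≤ k) (i : Fin n) : ¬ (m : ℤ) ∣ ν k i := by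
  intro hd
  have := Int.le_of_dvd (by linarith [(h.ν_mem k hk i).1]) hd
  linarith [(h.ν_mem k hk i).2]

/-- As m is prime, c·ν_k is nonzero mod m in every coordinate. The index `i` only provides one
coordinate to look at. -/
lemma notMem_of_mask_eq_zero (h : MoranData m R D ν) (i : Fin n) {k : ℕ} (hk : 1 ≤ k) {x : E n}
    (hx : mask (D k) x = 0) : x ∉ intLattice n := by
  obtain ⟨c, hc, z, rfl⟩ := (h.mask_eq_zero k hk x).1 hx
  rw [AddSubgroup.add_mem_cancel_right _ (toE_mem z), frac_mem_iff h.prime.ne_zero]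
  exact fun hd => not_dvd_mul h.prime hc (h.not_dvd_ν hk i) (hd i)

lemma act_pull (h : MoranData m R D ν) (k : ℕ) (x : E n) :
    act (R (k + 1)) (pull R (k + 1) x) = pull R k x :=
  Moran.act_pull (h.det_ne _ (by omega)) x

lemma pull_mem_of_le (h : MoranData m R D ν) {i j : ℕ} (hji : j ≤ i) {x : E n}
    (hx : pull R i x ∈ intLattice n) : pull R j x ∈ intLattice n := by
  induction i, hji using Nat.le_induction with
  | base => exact hx
  | succ i _ ih => exact ih (h.act_pull i x ▸ act_mem _ hx)

/-- Descending a level applies an integer matrix, which preserves ℤⁿ; a coset at level `p + d`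
therefore becomes a coset at level `p`. -/
lemma pull_eq_of_frac (h : MoranData m R D ν) {a : ℝ} {v : Fin n → ℤ} {x y : E n}
    (hy : y ∈ intLattice n) (d : ℕ) : ∀ p, pull R (p + d) x = a • toE v + y →
      ∃ y' ∈ intLattice n, pull R p x = a • toE (tr R p d v) + y' := by
  induction d with
  | zero => exact fun p hp => ⟨y, hy, hp⟩
  | succ d ih =>
    intro p hp
    obtain ⟨y', hy', h1⟩ := ih (p + 1) (by rw [← hp]; congr 2; omega)
    refine ⟨act (R (p + 1)) y', act_mem _ hy', ?_⟩
    rw [← h.act_pull, h1, map_add, map_smul, act_toE, tr]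

lemma pull_eq_of_mask_eq_zero (h : MoranData m R D ν) {p d : ℕ} (hpd : 1 ≤ p + d) {x : E n}
    (hx : mask (D (p + d)) (pull R (p + d) x) = 0) :
    ∃ c : ℕ, (1 ≤ c ∧ c ≤ m - 1) ∧ ∃ y ∈ intLattice n,
      pull R p x = ((c : ℝ) / (m : ℝ)) • toE (tr R p d (ν (p + d))) + y := by
  obtain ⟨c, hc, z, hz⟩ := (h.mask_eq_zero _ hpd _).1 hx
  exact ⟨c, hc, h.pull_eq_of_frac (toE_mem z) d p hz⟩

lemma smul_pull_mem (h : MoranData m R D ν) {p j : ℕ} (hj : 1 ≤ j) (hpj : p ≤ j) {x : E n}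
    (hx : mask (D j) (pull R j x) = 0) : (m : ℝ) • pull R p x ∈ intLattice n := by
  obtain ⟨d, rfl⟩ := Nat.exists_eq_add_of_le hpj
  obtain ⟨c, -, _, ⟨z, rfl⟩, hy⟩ := h.pull_eq_of_mask_eq_zero hj hx
  have hm : (m : ℝ) ≠ 0 := by exact_mod_cast h.prime.ne_zero
  rw [hy, smul_add, smul_smul, mul_div_cancel₀ _ hm]
  refine add_mem ⟨(c : ℤ) • tr R p d (ν (p + d)), ?_⟩ ⟨(m : ℤ) • z, ?_⟩ <;>
    rw [toE_zsmul] <;> push_cast <;> rfl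

end MoranData

/-! ### Necessity: splitting a spectrum into classes -/

/-- The vectors mapped into the integer lattice by `pull R i`; everything for `i = 0`. -/
def dualLattice (R : ℕ → Matrix (Fin n) (Fin n) ℤ) : ℕ → AddSubgroup (E n)
  | 0 => ⊤
  | i + 1 => (intLattice n).comap (pull R (i + 1)).toAddMonoidHom

lemma mem_dualLattice_succ {R : ℕ → Matrix (Fin n) (Fin n) ℤ} {i : ℕ} {x : E n} :
    x ∈ dualLattice R (i + 1) ↔ pull R (i + 1) x ∈ intLattice n := Iff.rfl

/-- Every class is compared with one base point of its own, and the residue mod `H'` of the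
difference to the base point is the finer label. -/
lemma exists_refined_classes {Λ : Set (E n)} {N : ℕ} {κ : Λ → Fin N} {H H' : AddSubgroup (E n)}
    (hκ : ∀ l l', κ l = κ l' → (l : E n) - l' ∈ H) {γ : Type*} [Fintype γ] (rep : γ → E n)
    (hrep : ∀ l l' : Λ, (l : E n) - l' ∈ H → ∃ g, (l : E n) - l' - rep g ∈ H') :
    ∃ κ' : Λ → Fin (N * Fintype.card γ), ∀ l l', κ' l = κ' l' → (l : E n) - l' ∈ H' := by
  let ref : Λ → Λ := fun l => Set.rangeSplitting κ (Set.rangeFactorization κ l)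
  have href : ∀ l, κ l = κ (ref l) := fun l =>
    (Set.apply_rangeSplitting κ (Set.rangeFactorization κ l)).symm
  have href' : ∀ l l', κ l = κ l' → ref l = ref l' := fun l l' h => by
    have : Set.rangeFactorization κ l = Set.rangeFactorization κ l' := Subtype.ext h
    simp only [ref, this]
  choose g hg using fun l => hrep l (ref l) (hκ _ _ (href l))
  refine ⟨fun l => finProdFinEquiv (κ l, Fintype.equivFin γ (g l)), fun l l' h => ?_⟩
  have h1 := finProdFinEquiv.injective h
  rw [Prod.mk.injEq] at h1
  have h2 := (Fintype.equivFin γ).injective h1.2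
  have h3 := sub_mem (hg l) (hg l')
  rw [href' l l' h1.1, h2] at h3
  convert h3 using 1
  abel

namespace MoranData

variable {m : ℕ} {R : ℕ → Matrix (Fin n) (Fin n) ℤ} {D : ℕ → Finset (Fin n → ℤ)}
  {ν : ℕ → Fin n → ℤ}

/-- Integrality at level `i` descends to all lower levels, where masks do not vanish on ℤⁿ. -/
lemma lt_of_mem_dualLattice (h : MoranData m R D ν) (i₀ : Fin n) {i j : ℕ} (hj : 1 ≤ j) {x : E n}
    (hx : x ∈ dualLattice R i) (hxj : mask (D j) (pull R j x) = 0) : i < j := by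
  by_contra! hji
  obtain ⟨i, rfl⟩ := Nat.exists_eq_succ_of_ne_zero (by omega : i ≠ 0)
  exact h.notMem_of_mask_eq_zero i₀ hj hxj (h.pull_mem_of_le hji hx)

/-- The differences of the points of `Λ` are zeros of the Fourier transform. -/
def IsBizero (R : ℕ → Matrix (Fin n) (Fin n) ℤ) (D : ℕ → Finset (Fin n → ℤ)) (Λ : Set (E n)) :
    Prop :=
  ∀ l l' : Λ, l ≠ l' → ∃ j, 1 ≤ j ∧ mask (D j) (pull R j ((l : E n) - l')) = 0

/-- Passing from level p to p+1 costs a factor m only: a zero of level p+1 contributes one of the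
m-1 cosets of ν_{p+1}, while a later zero lies in (1/m)ℤⁿ at level p+2 and R_{p+2} ≡ 0 mod m makes
it integral at level p+1. -/
lemma exists_classes (h : MoranData m R D ν) (i₀ : Fin n) {Λ : Set (E n)} (hΛ : IsBizero R D Λ)
    {p : ℕ} (hdvd : ∀ k, 2 ≤ k → k ≤ p + 1 → ∀ i j, (m : ℤ) ∣ R k i j) :
    ∃ κ : Λ → Fin (m ^ p), ∀ l l', κ l = κ l' → (l : E n) - l' ∈ dualLattice R p := by
  induction p with
  | zero => exact ⟨fun _ => 0, fun _ _ _ => AddSubgroup.mem_top _⟩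
  | succ p ih =>
    obtain ⟨κ, hκ⟩ := ih fun k hk hkp => hdvd k hk (by omega)
    choose s hs using pull_surjective h.det_ne (p + 1)
    have hm0 := h.prime.pos
    have := exists_refined_classes hκ (H' := dualLattice R (p + 1)) (γ := Fin m)
      (fun c => s ((((c : ℕ) : ℝ) / (m : ℝ)) • toE (ν (p + 1)))) fun l l' hl => ?_
    · rwa [Fintype.card_fin, ← pow_succ] at this
    · have hzero : pull R (p + 1) ((l : E n) - l') ∈ intLattice n →
          ∃ c : Fin m, (l : E n) - l' - s ((((c : ℕ) : ℝ) / (m : ℝ)) • toE (ν (p + 1)))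
            ∈ dualLattice R (p + 1) := fun hmem => by
        refine ⟨⟨0, hm0⟩, ?_⟩
        rw [mem_dualLattice_succ, map_sub, hs]
        simpa using hmem
      by_cases hll : l = l'
      · exact hzero (by simp [hll])
      obtain ⟨j, hj, hj0⟩ := hΛ l l' hll
      have hpj := h.lt_of_mem_dualLattice i₀ hj hl hj0
      rcases Nat.lt_or_ge (p + 1) j with hlt | hge
      · refine hzero ?_
        rw [← h.act_pull]
        exact act_mem_of_dvd (hdvd _ (by omega) (by omega)) (h.smul_pull_mem hj hlt hj0)
      · obtain rfl : j = p + 1 := by omega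
        obtain ⟨c, hc, z, hz⟩ := (h.mask_eq_zero _ hj _).1 hj0
        refine ⟨⟨c, by omega⟩, ?_⟩
        rw [mem_dualLattice_succ, map_sub, hs, hz, add_sub_cancel_left]
        exact toE_mem z

/-- The shifts `d` for which level `p + d` is not integral in the coordinates of level `p`. -/
def active (m : ℕ) (R : ℕ → Matrix (Fin n) (Fin n) ℤ) (ν : ℕ → Fin n → ℤ) (p : ℕ) : Set ℕ :=
  {d | ∃ i, ¬ (m : ℤ) ∣ tr R p d (ν (p + d)) i}

lemma one_add_mul_lt_pow {m s : ℕ} (hm : 2 ≤ m) (hs : 2 ≤ s) : 1 + s * (m - 1) < m ^ s := by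
  obtain ⟨k, rfl⟩ := Nat.exists_eq_add_of_le hm
  induction s, hs using Nat.le_induction with
  | base => simp; nlinarith
  | succ s hs ih =>
    rw [pow_succ]
    have : 2 + k - 1 = k + 1 := by omega
    rw [this] at ih ⊢
    refine lt_of_le_of_lt ?_ (Nat.mul_lt_mul_of_pos_right ih (by omega : 0 < 2 + k))
    nlinarith [Nat.zero_le (s * (k + 1) * (k + 1))]

/-- The strict inequality that contradicts the counting bound. Inactive shifts leave only the
residue 0, and each active one adds m-1 residues, whereas it multiplies the required number of
classes by m; two active shifts suffice to lose. -/
lemma exists_reps (h : MoranData m R D ν) {p : ℕ} (hp : 1 ≤ p) (h0 : 0 ∈ active m R ν p)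
    (h1 : 1 ∈ active m R ν p) :
    ∃ (J : Finset ℕ) (γ : Type) (_ : Fintype γ) (rep : γ → E n),
      (∀ d ∈ J, d ∈ active m R ν p) ∧ Fintype.card γ < m ^ J.card ∧
      ∀ x, (x = 0 ∨ ∃ d, mask (D (p + d)) (pull R (p + d) x) = 0) →
        ∃ g, pull R p x - rep g ∈ intLattice n := by
  classical
  have hm := h.prime.two_le
  have hm' : (m : ℝ) ≠ 0 := by exact_mod_cast h.prime.ne_zero
  by_cases hfin : (active m R ν p).Finite
  · set J := hfin.toFinset
    refine ⟨J, Option (J × Fin (m - 1)), inferInstance, fun o => o.elim 0 fun q =>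
      (((q.2 + 1 : ℕ) : ℝ) / (m : ℝ)) • toE (tr R p q.1 (ν (p + q.1))),
      fun d hd => hfin.mem_toFinset.1 hd, ?_, ?_⟩
    · have hJ : 2 ≤ J.card := by
        refine (Finset.card_pair zero_ne_one).symm.le.trans (Finset.card_le_card ?_)
        intro d hd
        simp only [Finset.mem_insert, Finset.mem_singleton] at hd
        rcases hd with rfl | rfl
        · exact hfin.mem_toFinset.2 h0
        · exact hfin.mem_toFinset.2 h1
      rw [Fintype.card_option, Fintype.card_prod, Fintype.card_coe, Fintype.card_fin, add_comm]
      exact one_add_mul_lt_pow hm hJ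
    · rintro x (rfl | ⟨d, hd⟩)
      · exact ⟨none, by simp⟩
      · obtain ⟨c, hc, y, hy, hxy⟩ := h.pull_eq_of_mask_eq_zero (by omega) hd
        by_cases hdJ : d ∈ J
        · refine ⟨some (⟨d, hdJ⟩, ⟨c - 1, by omega⟩), ?_⟩
          have : c - 1 + 1 = c := by omega
          simp only [Option.elim, this, hxy, add_sub_cancel_left]
          exact hy
        · refine ⟨none, ?_⟩
          have h2 : ∀ i, (m : ℤ) ∣ tr R p d (ν (p + d)) i := by
            have : d ∉ active m R ν p := fun hd => hdJ (hfin.mem_toFinset.2 hd)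
            simpa [active] using this
          simp only [Option.elim, sub_zero, hxy]
          exact add_mem ((frac_mem_iff h.prime.ne_zero c _).2 fun i => (h2 i).mul_left _) hy
  -- All zeros of level at least p lie in (1/m)ℤⁿ at level p, giving at most mⁿ residues; n+1 active
  -- shifts already demand more.
  · obtain ⟨J, hJ, hJc⟩ := (show (active m R ν p).Infinite from hfin).exists_subset_card_eq (n + 1)
    refine ⟨J, Fin n → Fin m, inferInstance,
      fun g => (m : ℝ)⁻¹ • toE fun i => ((g i : ℕ) : ℤ), fun d hd => hJ hd, ?_, ?_⟩
    · rw [hJc, Fintype.card_fun, Fintype.card_fin, Fintype.card_fin]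
      exact Nat.pow_lt_pow_right (by omega) (by omega)
    · intro x hx
      have hmem : (m : ℝ) • pull R p x ∈ intLattice n := by
        rcases hx with rfl | ⟨d, hd⟩
        · simp
        · exact h.smul_pull_mem (by omega) (by omega) hd
      obtain ⟨z, hz⟩ := hmem
      have hpos : (0 : ℤ) < m := by exact_mod_cast h.prime.pos
      have hz0 : ∀ i, 0 ≤ z i % m := fun i => Int.emod_nonneg _ hpos.ne'
      refine ⟨fun i => ⟨(z i % m).toNat, ?_⟩, fun i => z i / m, ?_⟩
      · have := Int.emod_lt_of_pos (z i) hpos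
        have := hz0 i
        omega
      · have hx' : pull R p x = (m : ℝ)⁻¹ • toE z := by rw [hz, smul_smul, inv_mul_cancel₀ hm', one_smul]
        ext i
        rw [hx']
        simp only [toE_apply, PiLp.sub_apply, PiLp.smul_apply, smul_eq_mul, Int.toNat_of_nonneg (hz0 i)]
        have := Int.emod_add_mul_ediv (z i) m
        have h3 : ((z i % m : ℤ) : ℝ) + m * ((z i / m : ℤ) : ℝ) = z i := by exact_mod_cast this
        rw [← h3]
        field_simp
        ring

/-- Spectrality forces `R k ≡ 0` mod `m` for `k ≥ 2`. -/
theorem dvd_of_isSpectral (h : MoranData m R D ν) (i₀ : Fin n)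
    (hν : ∀ k, 2 ≤ k → (∀ i, (m : ℤ) ∣ (R k).transpose.mulVec (ν k) i) → ∀ i j, (m : ℤ) ∣ R k i j)
    {c : ℕ → ℝ} (hc : Summable c) (hRc : ∀ j, ∀ᵐ x ∂(factor R D j), ‖x‖ ≤ c j)
    {μ : ProbabilityMeasure (E n)} (hμ : IsInfConv (factor R D) μ) (hspec : IsSpectral μ) :
    ∀ k, 2 ≤ k → ∀ i j, (m : ℤ) ∣ R k i j := by
  classical
  intro k
  induction k using Nat.strong_induction_on with
  | _ k ih =>
  intro hk
  by_contra hnot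
  obtain ⟨Λ, -, b, hb⟩ := hspec
  have hne : ∀ j, (imageSet (invProd R (j + 1)) (D (j + 1))).Nonempty := fun j => by
    rw [← Finset.card_pos, card_imageSet h.det_ne, h.card _ (by omega)]
    exact h.prime.pos
  have hprob : ∀ j, IsProbabilityMeasure (factor R D j) := fun j =>
    isProbabilityMeasure_uniformDirac (hne j)
  have hΛ : IsBizero R D Λ := fun l l' hl => by
    have h0 : ft (μ : Measure (E n)) ((l : E n) - l') = 0 := by
      rw [← inner_expLp, ← hb, ← hb]
      exact b.orthonormal.2 hl
    obtain ⟨j, hj⟩ := hμ.exists_charFun_eq_zero hc hRc h0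
    exact ⟨j + 1, by omega, by rw [← ft_factor h.det_ne]; exact hj⟩
  obtain ⟨q, rfl⟩ := Nat.exists_eq_add_of_le hk
  have hp : 1 ≤ q + 1 := by omega
  have h0 : 0 ∈ active m R ν (q + 1) := ⟨i₀, h.not_dvd_ν hp i₀⟩
  have h1 : 1 ∈ active m R ν (q + 1) := by
    by_contra hcon
    simp only [active, Set.mem_ofPred_eq, not_exists, not_not] at hcon
    refine hnot (hν (2 + q) hk ?_)
    rw [show 2 + q = q + 1 + 1 by omega]
    exact hcon
  obtain ⟨J, γ, _, rep, hJ, hcard, hrep⟩ := h.exists_reps hp h0 h1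
  obtain ⟨κ, hκ⟩ := h.exists_classes i₀ hΛ (p := q) fun k hk hkq => ih k (by omega) hk
  choose s hs using pull_surjective h.det_ne (q + 1)
  obtain ⟨κ', hκ'⟩ := exists_refined_classes hκ (H' := dualLattice R (q + 1))
    (fun g => s (rep g)) fun l l' hl => by
      obtain ⟨g, hg⟩ := hrep ((l : E n) - l') (by
        by_cases hll : l = l'
        · exact Or.inl (by simp [hll])
        · obtain ⟨j, hj, hj0⟩ := hΛ l l' hll
          have := h.lt_of_mem_dualLattice i₀ hj hl hj0
          obtain ⟨d, rfl⟩ := Nat.exists_eq_add_of_le (by omega : q + 1 ≤ j)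
          exact Or.inr ⟨d, hj0⟩)
      exact ⟨g, by rwa [mem_dualLattice_succ, map_sub, hs]⟩
  have hdisj : Disjoint (Finset.range q) (J.map (addLeftEmbedding q)) := by
    rw [Finset.disjoint_left]
    intro j hj hj'
    simp only [Finset.mem_map, addLeftEmbedding_apply] at hj'
    obtain ⟨d, -, rfl⟩ := hj'
    simp at hj
  -- Factor j belongs to level j+1, so the removed factors are levels 1,…,q and the active levels
  -- q+1+d. Differences within a class are integral at level q+1, which excludes zeros from all of
  -- these.
  have hle := hμ.pow_card_le (F := fun j => imageSet (invProd R (j + 1)) (D (j + 1))) hne hc hRc b hb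
    (m := m) (J := Finset.range q ∪ J.map (addLeftEmbedding q))
    (fun j _ => by rw [card_imageSet h.det_ne, h.card _ (by omega)]) κ' fun l l' hl hll => by
      obtain ⟨j, hj, hj0⟩ := hΛ l l' hl
      have hmem := hκ' l l' hll
      have hlt := h.lt_of_mem_dualLattice i₀ hj hmem hj0
      obtain ⟨d, rfl⟩ := Nat.exists_eq_add_of_le (by omega : q + 1 ≤ j)
      refine ⟨q + d, ?_, ?_⟩
      · simp only [Finset.mem_union, Finset.mem_range, Finset.mem_map, addLeftEmbedding_apply, not_or,
          not_exists, not_and]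
        refine ⟨by omega, fun d' hd' hdd => ?_⟩
        obtain rfl : d' = d := by omega
        obtain ⟨c, hc, y, hy, hxy⟩ := h.pull_eq_of_mask_eq_zero hj hj0
        rw [mem_dualLattice_succ, hxy, AddSubgroup.add_mem_cancel_right _ hy,
          frac_mem_iff h.prime.ne_zero] at hmem
        obtain ⟨i, hi⟩ := hJ d' hd'
        exact not_dvd_mul h.prime hc hi (hmem i)
      · have := ft_factor h.det_ne D (q + d) ((l : E n) - l')
        rw [show q + d + 1 = q + 1 + d by omega, hj0] at this
        exact this
  rw [Finset.card_union_of_disjoint hdisj, Finset.card_range, Finset.card_map, Fintype.card_fin,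
    pow_add] at hle
  exact absurd (Nat.le_of_mul_le_mul_left hle (pow_pos h.prime.pos q)) (not_le.2 hcard)

end MoranData

/-! ### Sufficiency: building a spectrum -/

lemma mask_neg (D : Finset (Fin n → ℤ)) (x : E n) :
    mask D (-x) = (starRingEnd ℂ) (mask D x) := by
  simp_rw [mask_eq, map_mul, map_sum, conj_e2, map_inv₀, Complex.conj_natCast]

/-- A lower bound for all partial products, uniform in the factors. -/
lemma exists_le_prod {u : ℕ → ℝ} (hu : Summable u) (hu0 : ∀ i, 0 ≤ u i) {ε : ℝ} (hε : 0 < ε)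
    (hε1 : ε ≤ 1) : ∃ δ > 0, ∀ t : ℕ → ℝ, (∀ i, ε ≤ t i) → (∀ i, 1 - u i ≤ t i) →
      ∀ L, δ ≤ ∏ i ∈ Finset.range L, t i := by
  -- The smallest sequence allowed for `t`; its infinite product is positive and serves as `δ`.
  let g : ℕ → ℝ := fun i => max ε (1 - u i)
  have hg0 : ∀ i, 0 < g i := fun i => hε.trans_le (le_max_left _ _)
  have hg1 : ∀ i, g i ≤ 1 := fun i => max_le hε1 (by linarith [hu0 i])
  have hsum : Summable fun i => ‖g i - 1‖ := by
    refine Summable.of_nonneg_of_le (fun _ => norm_nonneg _) (fun i => ?_) hu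
    rw [Real.norm_eq_abs, abs_le]
    constructor
    · linarith [le_max_right ε (1 - u i)]
    · linarith [hg1 i, hu0 i]
  have hne : ∏' i, g i ≠ 0 := by
    have := tprod_one_add_ne_zero_of_summable (f := fun i => g i - 1)
      (fun i => by simpa using (hg0 i).ne') hsum
    simpa using this
  have htend : Tendsto (fun L => ∏ i ∈ Finset.range L, g i) atTop (𝓝 (∏' i, g i)) := by
    have h := (multipliable_one_add_of_summable hsum).hasProd.tendsto_prod_nat
    simpa using h
  have hanti : Antitone fun L => ∏ i ∈ Finset.range L, g i := antitone_nat_of_succ_le fun L => by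
    rw [Finset.prod_range_succ]
    exact mul_le_of_le_one_right (Finset.prod_nonneg fun i _ => (hg0 i).le) (hg1 L)
  refine ⟨∏' i, g i, lt_of_le_of_ne (ge_of_tendsto' htend fun L =>
    Finset.prod_nonneg fun i _ => (hg0 i).le) hne.symm, fun t h1 h2 L => ?_⟩
  exact (hanti.le_of_tendsto htend L).trans
    (Finset.prod_le_prod (fun i _ => (hg0 i).le) fun i _ => max_le (h1 i) (h2 i))

/-- Bounded integer digits leave finitely many digit sets, so positive bounds for single masks
become uniform. -/
lemma finite_of_bounded {D : ℕ → Finset (Fin n → ℤ)} {C : ℝ}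
    (hD : ∀ k, 1 ≤ k → ∀ d ∈ D k, ‖toE d‖ ≤ C) : {S | ∃ k, 1 ≤ k ∧ S = D k}.Finite := by
  obtain ⟨N, hN⟩ := exists_nat_gt C
  refine ((Finset.Icc (fun _ : Fin n => -(N : ℤ)) (fun _ => (N : ℤ))).powerset.finite_toSet).subset ?_
  rintro _ ⟨k, hk, rfl⟩
  rw [Finset.mem_coe, Finset.mem_powerset]
  intro d hd
  have h1 : ∀ i, |(d i : ℝ)| ≤ N := fun i =>
    ((PiLp.norm_apply_le (toE d) i).trans (hD k hk d hd)).trans hN.le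
  have h2 : ∀ i, |d i| ≤ (N : ℤ) := fun i => by exact_mod_cast h1 i
  rw [Finset.mem_Icc]
  exact ⟨fun i => (abs_le.1 (h2 i)).1, fun i => (abs_le.1 (h2 i)).2⟩

namespace MoranData

variable {m : ℕ} {R : ℕ → Matrix (Fin n) (Fin n) ℤ} {D : ℕ → Finset (Fin n → ℤ)}
  {ν : ℕ → Fin n → ℤ}

lemma mask_sub_smul (h : MoranData m R D ν) {k : ℕ} (hk : 1 ≤ k) {c c' : Fin m} (hc : c ≠ c') :
    mask (D k) ((((c : ℕ) : ℝ) / (m : ℝ)) • toE (ν k) - (((c' : ℕ) : ℝ) / (m : ℝ)) • toE (ν k)) = 0 := by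
  have key : ∀ {c c' : Fin m}, c < c' →
      mask (D k) ((((c' : ℕ) : ℝ) / (m : ℝ)) • toE (ν k)
        - (((c : ℕ) : ℝ) / (m : ℝ)) • toE (ν k)) = 0 := fun {c c'} hlt => by
    have hlt' : (c : ℕ) < c' := hlt
    rw [h.mask_eq_zero k hk]
    refine ⟨(c' : ℕ) - c, ⟨by omega, by omega⟩, 0, ?_⟩
    rw [toE_zero, add_zero, ← sub_smul, Nat.cast_sub hlt'.le, sub_div]
  rcases lt_or_gt_of_ne hc with hlt | hlt
  · rw [← neg_sub, mask_neg, key hlt, map_zero]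
  · exact key hlt

/-- The exponentials at `(c/m) ν` form a unitary matrix on the digit set. -/
lemma sum_norm_mask_sq (h : MoranData m R D ν) {k : ℕ} (hk : 1 ≤ k) (x : E n) :
    ∑ c : Fin m, ‖mask (D k) (x + (((c : ℕ) : ℝ) / (m : ℝ)) • toE (ν k))‖ ^ 2 = 1 := by
  classical
  have hm : (m : ℂ) ≠ 0 := by exact_mod_cast h.prime.ne_zero
  have hcard := h.card k hk
  let p : Fin m → E n := fun c => (((c : ℕ) : ℝ) / (m : ℝ)) • toE (ν k)
  let H : Matrix (Fin m) (D k) ℂ := Matrix.of fun c d => e2 (p c) (toE d)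
  -- Rows are orthogonal because differences of the (c/m)ν are zeros of the mask. `H` is square,
  -- since #D = m, so its columns are orthogonal too and it preserves norms up to √m.
  have h1 : H * ((m : ℂ)⁻¹ • H.conjTranspose) = 1 := by
    ext c c'
    have h2 : (H * ((m : ℂ)⁻¹ • H.conjTranspose)) c c' = mask (D k) (p c - p c') := by
      rw [mask_eq, hcard, Matrix.mul_apply, Finset.mul_sum,
        ← Finset.sum_coe_sort (D k) (fun d => (m : ℂ)⁻¹ * e2 (p c - p c') (toE d))]
      refine Finset.sum_congr rfl fun d _ => ?_
      simp only [H, Matrix.smul_apply, Matrix.conjTranspose_apply, Matrix.of_apply, smul_eq_mul]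
      rw [RCLike.star_def, conj_e2, sub_eq_add_neg, e2_add_left]
      ring
    rw [h2, Matrix.one_apply]
    split_ifs with hc
    · rw [hc, sub_self, mask_zero (by rw [hcard]; exact h.prime.ne_zero)]
    · exact h.mask_sub_smul hk hc
  have h3 : ((m : ℂ)⁻¹ • H.conjTranspose) * H = 1 :=
    (Matrix.mul_eq_one_comm_of_card_eq (Fin m) (D k) ℂ (by simp [hcard])).1 h1
  have h4 : H.conjTranspose * H = (m : ℂ) • 1 := by
    rw [← h3, Matrix.smul_mul, smul_smul, mul_inv_cancel₀ hm, one_smul]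
  let v : D k → ℂ := fun d => e2 x (toE d)
  have h5 : ∀ c, mask (D k) (x + p c) = (m : ℂ)⁻¹ * H.mulVec v c := fun c => by
    rw [mask_eq, hcard, Matrix.mulVec, dotProduct,
      ← Finset.sum_coe_sort (D k) (fun d => e2 (x + p c) (toE d))]
    congr 1
    refine Finset.sum_congr rfl fun d _ => ?_
    simp only [H, v, Matrix.of_apply, e2_add_left]
    ring
  have h6 : star (H.mulVec v) ⬝ᵥ H.mulVec v = (m : ℂ) * m := by
    rw [Matrix.star_mulVec, ← Matrix.dotProduct_mulVec, Matrix.mulVec_mulVec, h4,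
      Matrix.smul_mulVec, Matrix.one_mulVec, dotProduct_smul, smul_eq_mul, dotProduct]
    congr 1
    have h7 : ∀ d : D k, star v d * v d = 1 := fun d => by
      simp only [v, Pi.star_apply, RCLike.star_def]
      rw [conj_e2, ← e2_add_left, neg_add_cancel, e2_zero_left]
    rw [Finset.sum_congr rfl fun d _ => h7 d]
    simp [hcard]
  have h8 : ((∑ c : Fin m, ‖H.mulVec v c‖ ^ 2 : ℝ) : ℂ) = (m : ℂ) * m := by
    rw [← h6, dotProduct]
    push_cast
    refine Finset.sum_congr rfl fun c _ => ?_
    rw [Pi.star_apply, RCLike.star_def, ← Complex.normSq_eq_conj_mul_self,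
      Complex.normSq_eq_norm_sq]
    push_cast
    rfl
  have h9 : (∑ c : Fin m, ‖H.mulVec v c‖ ^ 2 : ℝ) = (m : ℝ) * m := by exact_mod_cast h8
  have hm' : (m : ℝ) ≠ 0 := by exact_mod_cast h.prime.ne_zero
  calc ∑ c : Fin m, ‖mask (D k) (x + p c)‖ ^ 2
      = ∑ c : Fin m, ((m : ℝ)⁻¹ * (m : ℝ)⁻¹) * ‖H.mulVec v c‖ ^ 2 := by
        refine Finset.sum_congr rfl fun c _ => ?_
        rw [h5, norm_mul, norm_inv, Complex.norm_natCast]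
        ring
    _ = 1 := by
        rw [← Finset.mul_sum, h9]
        field_simp

end MoranData

/-- The representative of `(c/m) v` modulo `ℤⁿ` with coordinates in `[-1/2, 1/2]`. -/
def centered (m : ℕ) (v : Fin n → ℤ) (c : ℕ) : E n :=
  ((c : ℝ) / (m : ℝ)) • toE v - toE fun i => round ((c : ℝ) / (m : ℝ) * v i)

lemma abs_centered_le (m : ℕ) (v : Fin n → ℤ) (c : ℕ) (i : Fin n) :
    |centered m v c i| ≤ 1 / 2 :=
  abs_sub_round _

lemma centered_zero (m : ℕ) (v : Fin n → ℤ) : centered m v 0 = 0 := by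
  ext i
  simp [centered, toE_apply]

lemma smul_centered_mem {m : ℕ} (hm : m ≠ 0) (v : Fin n → ℤ) (c : ℕ) :
    (m : ℝ) • centered m v c ∈ intLattice n := by
  have hm' : (m : ℝ) ≠ 0 := by exact_mod_cast hm
  rw [centered, smul_sub, smul_smul, mul_div_cancel₀ _ hm']
  refine sub_mem ⟨(c : ℤ) • v, ?_⟩ ⟨(m : ℤ) • fun i => round ((c : ℝ) / (m : ℝ) * v i), ?_⟩ <;>
    rw [toE_zsmul] <;> push_cast <;> rfl

lemma mask_add_centered (S : Finset (Fin n → ℤ)) (x : E n) (m : ℕ) (v : Fin n → ℤ) (c : ℕ) :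
    mask S (x + centered m v c) = mask S (x + ((c : ℝ) / (m : ℝ)) • toE v) := by
  rw [centered, ← add_sub_assoc, sub_eq_add_neg, mask_add_of_mem _ _ (neg_mem (toE_mem _))]

namespace MoranData

variable {m : ℕ} {R : ℕ → Matrix (Fin n) (Fin n) ℤ} {D : ℕ → Finset (Fin n → ℤ)}
  {ν : ℕ → Fin n → ℤ}

/-- Each coordinate of a zero is 1/m times a nonzero integer. Hence one small coordinate is enough
to keep away from the zero set. -/
lemma inv_le_abs_of_mask_eq_zero (h : MoranData m R D ν) {k : ℕ} (hk : 1 ≤ k) {x : E n}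
    (hx : mask (D k) x = 0) (i : Fin n) : (m : ℝ)⁻¹ ≤ |x i| := by
  obtain ⟨c, hc, z, rfl⟩ := (h.mask_eq_zero k hk x).1 hx
  have hm : (0 : ℝ) < m := by exact_mod_cast h.prime.pos
  have h1 : (((c : ℝ) / (m : ℝ)) • toE (ν k) + toE z) i = (m : ℝ)⁻¹ * ((c * ν k i + m * z i : ℤ) : ℝ) := by
    simp only [PiLp.add_apply, PiLp.smul_apply, toE_apply, smul_eq_mul]
    push_cast
    field_simp
  have h2 : (c * ν k i + m * z i : ℤ) ≠ 0 := fun h0 =>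
    not_dvd_mul h.prime hc (h.not_dvd_ν hk i) ⟨-z i, by linarith⟩
  rw [h1, abs_mul, abs_of_pos (inv_pos.2 hm)]
  have h3 : (1 : ℝ) ≤ |((c * ν k i + m * z i : ℤ) : ℝ)| := by exact_mod_cast Int.one_le_abs h2
  exact le_mul_of_one_le_right (inv_pos.2 hm).le h3

/-- The masks are uniformly bounded below on bounded sets away from their zeros. -/
lemma exists_le_norm_mask (h : MoranData m R D ν) (i₀ : Fin n) {C : ℝ}
    (hD : ∀ k, 1 ≤ k → ∀ d ∈ D k, ‖toE d‖ ≤ C) (B : ℝ) {r : ℝ} (hr : r < (m : ℝ)⁻¹) :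
    ∃ ε > 0, ε ≤ 1 ∧ ∀ k, 1 ≤ k → ∀ x : E n, (∀ i, |x i| ≤ B) → |x i₀| ≤ r →
      ε ≤ ‖mask (D k) x‖ := by
  let K : Set (E n) := {x | (∀ i, |x i| ≤ B) ∧ |x i₀| ≤ r}
  have hKc : IsClosed K := by
    have : K = (⋂ i, {x : E n | |x i| ≤ B}) ∩ {x | |x i₀| ≤ r} := by ext; simp [K]
    rw [this]
    exact (isClosed_iInter fun i => isClosed_le (by fun_prop) (by fun_prop)).inter
      (isClosed_le (by fun_prop) (by fun_prop))
  have hKb : Bornology.IsBounded K := by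
    refine (Metric.isBounded_iff_subset_closedBall 0).2 ⟨Real.sqrt (∑ _i : Fin n, B ^ 2), ?_⟩
    intro x hx
    rw [mem_closedBall_zero_iff, EuclideanSpace.norm_eq]
    refine Real.sqrt_le_sqrt (Finset.sum_le_sum fun i _ => ?_)
    have := hx.1 i
    rw [Real.norm_eq_abs]
    gcongr
  have hK : IsCompact K := Metric.isCompact_of_isClosed_isBounded hKc hKb
  have hone : ∀ S ∈ {S | ∃ k, 1 ≤ k ∧ S = D k}, ∃ ε : Set.Ioi (0 : ℝ), ∀ x ∈ K, (ε : ℝ) ≤ ‖mask S x‖ := by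
    rintro _ ⟨k, hk, rfl⟩
    rcases K.eq_empty_or_nonempty with hE | hne
    · exact ⟨⟨1, Set.mem_Ioi.2 one_pos⟩, by simp [hE]⟩
    obtain ⟨y, hy, hmin⟩ := hK.exists_isMinOn hne (continuous_mask (D k)).norm.continuousOn
    refine ⟨⟨‖mask (D k) y‖, norm_pos_iff.2 fun h0 => ?_⟩, fun x hx => hmin hx⟩
    exact absurd (h.inv_le_abs_of_mask_eq_zero hk h0 i₀) (not_le.2 (hy.2.trans_lt hr))
  choose! ε hε using hone
  obtain ⟨M, hM⟩ := ((finite_of_bounded hD).image ε).bddBelow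
  refine ⟨min M 1, lt_min M.2 one_pos, min_le_right _ _, fun k hk x hx hx0 => ?_⟩
  refine (min_le_left _ _).trans (le_trans ?_ (hε _ ⟨k, hk, rfl⟩ x ⟨hx, hx0⟩))
  exact hM ⟨D k, ⟨k, hk, rfl⟩, rfl⟩

lemma norm_mask_sub_one_le_of_abs_le (h : MoranData m R D ν) {C : ℝ}
    (hD : ∀ k, 1 ≤ k → ∀ d ∈ D k, ‖toE d‖ ≤ C) {k : ℕ} (hk : 1 ≤ k) {x : E n} {B : ℝ}
    (hx : ∀ i, |x i| ≤ B) : ‖mask (D k) x - 1‖ ≤ 2 * Real.pi * (n * (B * C)) := by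
  refine norm_mask_sub_one_le (by rw [h.card k hk]; exact h.prime.ne_zero) x fun d hd => ?_
  rw [PiLp.inner_apply]
  refine (Finset.abs_sum_le_sum_abs _ _).trans ?_
  have : ∀ i ∈ Finset.univ, |(inner ℝ (x i) (toE d i) : ℝ)| ≤ B * C := fun i _ => by
    rw [RCLike.inner_apply, conj_trivial, abs_mul, mul_comm]
    have h1 : |toE d i| ≤ C := (PiLp.norm_apply_le (toE d) i).trans (hD k hk d hd)
    have h2 := hx i
    have h3 : 0 ≤ B := (abs_nonneg _).trans h2
    gcongr
  simpa using Finset.sum_le_sum this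

end MoranData

/-- From level `2` on, the matrices vanish mod `m` and the transposed inverses contract. -/
structure IsContracting (m : ℕ) (R : ℕ → Matrix (Fin n) (Fin n) ℤ) (i₀ : Fin n) : Prop where
  three_le : 3 ≤ m
  dvd : ∀ k, 2 ≤ k → ∀ i j, (m : ℤ) ∣ R k i j
  abs_le : ∀ k, 2 ≤ k → ∀ (x : E n) (B : ℝ), (∀ i, |act (R k) x i| ≤ B) → ∀ i, |x i| ≤ 2 / 3 * B
  mul_abs_le : ∀ k, 2 ≤ k → ∀ x : E n, m * |x i₀| ≤ |act (R k) x i₀|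

/-- A vector with prescribed image under `pull R k`. -/
def shift (R : ℕ → Matrix (Fin n) (Fin n) ℤ) (k : ℕ) (w : E n) : E n :=
  Function.invFun (pull R k) w

open Classical in
/-- The finite approximations of a spectrum of the Moran measure. -/
def approxSpectrum (m : ℕ) (R : ℕ → Matrix (Fin n) (Fin n) ℤ) (ν : ℕ → Fin n → ℤ) : ℕ → Finset (E n)
  | 0 => {0}
  | k + 1 => (approxSpectrum m R ν k ×ˢ (Finset.univ : Finset (Fin m))).image fun q =>
      q.1 + shift R (k + 1) (centered m (ν (k + 1)) q.2)

/-- The squared modulus of the Fourier transform of the `k`-th partial convolution. -/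
def partialSq (R : ℕ → Matrix (Fin n) (Fin n) ℤ) (D : ℕ → Finset (Fin n → ℤ)) (k : ℕ) (x : E n) : ℝ :=
  ∏ j ∈ Finset.range k, ‖mask (D (j + 1)) (pull R (j + 1) x)‖ ^ 2

namespace MoranData

variable {m : ℕ} {R : ℕ → Matrix (Fin n) (Fin n) ℤ} {D : ℕ → Finset (Fin n → ℤ)}
  {ν : ℕ → Fin n → ℤ} {i₀ : Fin n}

lemma pull_shift (h : MoranData m R D ν) (k : ℕ) (w : E n) : pull R k (shift R k w) = w :=
  Function.rightInverse_invFun (pull_surjective h.det_ne k) w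

lemma shift_zero (h : MoranData m R D ν) (k : ℕ) : shift R k 0 = 0 :=
  pull_injective h.det_ne k (by rw [h.pull_shift, map_zero])

lemma mem_approxSpectrum_succ {k : ℕ} {x : E n} :
    x ∈ approxSpectrum m R ν (k + 1) ↔ ∃ l ∈ approxSpectrum m R ν k, ∃ c : Fin m,
      l + shift R (k + 1) (centered m (ν (k + 1)) c) = x := by
  simp [approxSpectrum]

lemma approxSpectrum_mono (h : MoranData m R D ν) : Monotone (approxSpectrum m R ν) := by
  refine monotone_nat_of_le_succ fun k l hl => mem_approxSpectrum_succ.2 ⟨l, hl, ⟨0, h.prime.pos⟩, ?_⟩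
  simp [centered_zero, h.shift_zero]

/-- The points added at level k+1 are invisible to the masks of earlier levels: R_{k+1} ≡ 0 mod m
clears the denominator m. -/
lemma pull_shift_mem (h : MoranData m R D ν) (hR : IsContracting m R i₀) {j k : ℕ} (hj : 1 ≤ j)
    (hjk : j ≤ k) (c : ℕ) :
    pull R j (shift R (k + 1) (centered m (ν (k + 1)) c)) ∈ intLattice n := by
  refine h.pull_mem_of_le hjk ?_
  rw [← h.act_pull, h.pull_shift]
  exact act_mem_of_dvd (hR.dvd _ (by omega)) (smul_centered_mem h.prime.ne_zero _ _)

lemma mask_pull_add_shift (h : MoranData m R D ν) (hR : IsContracting m R i₀) {j k : ℕ} (hj : 1 ≤ j)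
    (hjk : j ≤ k) (c : ℕ) (x : E n) (S : Finset (Fin n → ℤ)) :
    mask S (pull R j (x + shift R (k + 1) (centered m (ν (k + 1)) c))) = mask S (pull R j x) := by
  rw [map_add, mask_add_of_mem _ _ (h.pull_shift_mem hR hj hjk c)]

lemma mask_step_eq_zero (h : MoranData m R D ν) (hR : IsContracting m R i₀) {k : ℕ}
    (ih : ∀ l ∈ approxSpectrum m R ν k, ∀ l' ∈ approxSpectrum m R ν k, l ≠ l' →
      ∃ j, (1 ≤ j ∧ j ≤ k) ∧ mask (D j) (pull R j (l - l')) = 0)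
    {l l' : E n} (hl : l ∈ approxSpectrum m R ν k) (hl' : l' ∈ approxSpectrum m R ν k)
    {c c' : Fin m} (hne : (l, c) ≠ (l', c')) :
    ∃ j, (1 ≤ j ∧ j ≤ k + 1) ∧ mask (D j) (pull R j
      (l + shift R (k + 1) (centered m (ν (k + 1)) c)
        - (l' + shift R (k + 1) (centered m (ν (k + 1)) c')))) = 0 := by
  by_cases hll : l = l'
  · subst hll
    have hc : c ≠ c' := fun hc => hne (by rw [hc])
    refine ⟨k + 1, ⟨by omega, le_rfl⟩, ?_⟩
    rw [add_sub_add_left_eq_sub, map_sub, h.pull_shift, h.pull_shift, centered, centered,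
      ← h.mask_sub_smul (by omega : 1 ≤ k + 1) hc, ← mask_add_of_mem _ _ (sub_mem
        (toE_mem fun i => round (((c : ℕ) : ℝ) / (m : ℝ) * ν (k + 1) i))
        (toE_mem fun i => round (((c' : ℕ) : ℝ) / (m : ℝ) * ν (k + 1) i)))]
    congr 1
    abel
  · obtain ⟨j, ⟨hj1, hjk⟩, hj0⟩ := ih l hl l' hl' hll
    refine ⟨j, ⟨hj1, by omega⟩, ?_⟩
    rw [add_sub_add_comm, map_add, map_sub _ (shift _ _ _), mask_add_of_mem _ _
      (sub_mem (h.pull_shift_mem hR hj1 hjk c) (h.pull_shift_mem hR hj1 hjk c')), hj0]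

lemma exists_mask_eq_zero (h : MoranData m R D ν) (hR : IsContracting m R i₀) (k : ℕ) :
    ∀ l ∈ approxSpectrum m R ν k, ∀ l' ∈ approxSpectrum m R ν k, l ≠ l' →
      ∃ j, (1 ≤ j ∧ j ≤ k) ∧ mask (D j) (pull R j (l - l')) = 0 := by
  induction k with
  | zero =>
    intro l hl l' hl' hne
    simp only [approxSpectrum, Finset.mem_singleton] at hl hl'
    exact absurd (hl.trans hl'.symm) hne
  | succ k ih =>
    intro x hx x' hx' hne
    obtain ⟨l, hl, c, rfl⟩ := mem_approxSpectrum_succ.1 hx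
    obtain ⟨l', hl', c', rfl⟩ := mem_approxSpectrum_succ.1 hx'
    refine h.mask_step_eq_zero hR ih hl hl' fun heq => hne ?_
    rw [Prod.mk.injEq] at heq
    rw [heq.1, heq.2]

/-- The shifts at level k+1 do not change the first k factors, and the new factors sum to 1 over c
by unitarity. -/
lemma sum_partialSq (h : MoranData m R D ν) (hR : IsContracting m R i₀) (ξ : E n) (k : ℕ) :
    ∑ l ∈ approxSpectrum m R ν k, partialSq R D k (ξ + l) = 1 := by
  classical
  induction k with
  | zero => simp [approxSpectrum, partialSq]
  | succ k ih =>
    have hinj : Set.InjOn (fun q : E n × Fin m =>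
        q.1 + shift R (k + 1) (centered m (ν (k + 1)) q.2))
        (approxSpectrum m R ν k ×ˢ (Finset.univ : Finset (Fin m)) : Finset (E n × Fin m)) := by
      rintro ⟨l, c⟩ hq ⟨l', c'⟩ hq' heq
      by_contra hne
      simp only [Finset.coe_product, Set.mem_prod, Finset.mem_coe] at hq hq'
      obtain ⟨j, ⟨hj, -⟩, hj0⟩ := h.mask_step_eq_zero hR (h.exists_mask_eq_zero hR k) hq.1 hq'.1 hne
      simp only at heq
      rw [heq, sub_self, map_zero, mask_zero (by rw [h.card j hj]; exact h.prime.ne_zero)] at hj0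
      exact one_ne_zero hj0
    have hset : approxSpectrum m R ν (k + 1)
        = (approxSpectrum m R ν k ×ˢ (Finset.univ : Finset (Fin m))).image fun q =>
          q.1 + shift R (k + 1) (centered m (ν (k + 1)) q.2) := by
      rw [approxSpectrum]
    rw [hset, Finset.sum_image hinj, Finset.sum_product, ← ih]
    refine Finset.sum_congr rfl fun l _ => ?_
    have hterm : ∀ c : Fin m,
        partialSq R D (k + 1) (ξ + (l + shift R (k + 1) (centered m (ν (k + 1)) c)))
          = partialSq R D k (ξ + l) * ‖mask (D (k + 1)) (pull R (k + 1) (ξ + l)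
            + (((c : ℕ) : ℝ) / (m : ℝ)) • toE (ν (k + 1)))‖ ^ 2 := fun c => by
      rw [partialSq, Finset.prod_range_succ, ← add_assoc, map_add _ (ξ + l), h.pull_shift,
        mask_add_centered, partialSq]
      congr 1
      refine Finset.prod_congr rfl fun j hj => ?_
      rw [h.mask_pull_add_shift hR (by omega) (Finset.mem_range.1 hj)]
    simp only [hterm]
    rw [← Finset.mul_sum, h.sum_norm_mask_sq (by omega), mul_one]

lemma abs_pull_succ_le (h : MoranData m R D ν) (hR : IsContracting m R i₀) {k : ℕ} (hk : 1 ≤ k)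
    {x : E n} {B : ℝ} (hx : ∀ i, |pull R k x i| ≤ B) (i : Fin n) :
    |pull R (k + 1) x i| ≤ 2 / 3 * B :=
  hR.abs_le (k + 1) (by omega) _ B (fun i => by rw [h.act_pull]; exact hx i) i

lemma mul_abs_pull_succ_le (h : MoranData m R D ν) (hR : IsContracting m R i₀) {k : ℕ} (hk : 1 ≤ k)
    (x : E n) : m * |pull R (k + 1) x i₀| ≤ |pull R k x i₀| := by
  rw [← h.act_pull k x]
  exact hR.mul_abs_le (k + 1) (by omega) _

lemma three_mul_abs_pull_succ_le (h : MoranData m R D ν) (hR : IsContracting m R i₀) {k : ℕ}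
    (hk : 1 ≤ k) (x : E n) : 3 * |pull R (k + 1) x i₀| ≤ |pull R k x i₀| := by
  refine le_trans ?_ (h.mul_abs_pull_succ_le hR hk x)
  have : (3 : ℝ) ≤ m := by exact_mod_cast hR.three_le
  gcongr

lemma abs_pull_add_le (h : MoranData m R D ν) (hR : IsContracting m R i₀) {k : ℕ} (hk : 1 ≤ k)
    {x : E n} {B : ℝ} (hx : ∀ i, |pull R k x i| ≤ B) (d : ℕ) :
    ∀ i, |pull R (k + d) x i| ≤ (2 / 3) ^ d * B := by
  induction d with
  | zero => simpa using hx
  | succ d ih =>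
    intro i
    have := h.abs_pull_succ_le hR (by omega : 1 ≤ k + d) ih i
    rw [pow_succ', ← add_assoc]
    linarith

lemma abs_pull_first_add_le (h : MoranData m R D ν) (hR : IsContracting m R i₀) {k : ℕ} (hk : 1 ≤ k)
    (x : E n) (d : ℕ) : |pull R (k + d) x i₀| ≤ |pull R k x i₀| := by
  induction d with
  | zero => exact le_rfl
  | succ d ih =>
    have := h.three_mul_abs_pull_succ_le hR (by omega : 1 ≤ k + d) x
    rw [← add_assoc]
    linarith [abs_nonneg (pull R (k + d + 1) x i₀)]

/-- The constants are fixed by the recursion "contract, then add a centred vector": 2/3 · 3/2 + 1/2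
= 3/2 in general, and 1/3 · 3/4 + 1/2 = 3/4 in the coordinate `i₀`. -/
lemma abs_pull_approxSpectrum_le (h : MoranData m R D ν) (hR : IsContracting m R i₀) (k : ℕ) :
    ∀ l ∈ approxSpectrum m R ν (k + 1), (∀ i, |pull R (k + 1) l i| ≤ 3 / 2) ∧
      |pull R (k + 1) l i₀| ≤ 3 / 4 := by
  have hpull : ∀ k (l : E n) (c : Fin m) i,
      |pull R (k + 1) (l + shift R (k + 1) (centered m (ν (k + 1)) c)) i|
        ≤ |pull R (k + 1) l i| + 1 / 2 := fun k l c i => by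
    rw [map_add, h.pull_shift, PiLp.add_apply]
    exact (abs_add_le _ _).trans (add_le_add le_rfl (abs_centered_le _ _ _ _))
  induction k with
  | zero =>
    intro x hx
    obtain ⟨l, hl, c, rfl⟩ := mem_approxSpectrum_succ.1 hx
    simp only [approxSpectrum, Finset.mem_singleton] at hl
    subst hl
    have h1 := hpull 0 0 c
    simp only [map_zero, PiLp.zero_apply, abs_zero, zero_add] at h1 ⊢
    exact ⟨fun i => (h1 i).trans (by norm_num), (h1 i₀).trans (by norm_num)⟩
  | succ k ih =>
    intro x hx
    obtain ⟨l, hl, c, rfl⟩ := mem_approxSpectrum_succ.1 hx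
    obtain ⟨h1, h2⟩ := ih l hl
    refine ⟨fun i => (hpull (k + 1) l c i).trans ?_, (hpull (k + 1) l c i₀).trans ?_⟩
    · have := h.abs_pull_succ_le hR (by omega) h1 i
      linarith
    · have := h.three_mul_abs_pull_succ_le hR (by omega : 1 ≤ k + 1) l
      linarith

/-- The tails of the infinite product are uniformly bounded below on the relevant region. -/
lemma exists_le_prod_tail (h : MoranData m R D ν) (hR : IsContracting m R i₀) {C : ℝ} (hC : 0 ≤ C)
    (hD : ∀ k, 1 ≤ k → ∀ d ∈ D k, ‖toE d‖ ≤ C) :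
    ∃ δ > 0, ∀ k, 1 ≤ k → ∀ x, (∀ i, |pull R k x i| ≤ 2) → |pull R k x i₀| ≤ 7 / 8 →
      ∀ L, δ ≤ ∏ d ∈ Finset.range L, ‖mask (D (k + d + 1)) (pull R (k + d + 1) x)‖ := by
  have hm : (0 : ℝ) < m := by exact_mod_cast h.prime.pos
  -- One more level divides the coordinate `i₀` by at least m, so a bound 7/8 becomes (7/8)/m, below
  -- the threshold 1/m for zeros.
  obtain ⟨ε, hε, hε1, hmask⟩ := h.exists_le_norm_mask i₀ hD 2 (r := 7 / 8 * (m : ℝ)⁻¹)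
    (by nlinarith [inv_pos.2 hm])
  obtain ⟨δ, hδ, hprod⟩ := exists_le_prod
    (u := fun d => 2 * Real.pi * (n * ((2 / 3 : ℝ) ^ d * 2 * C)))
    (((((summable_geometric_of_lt_one (by norm_num) (by norm_num)).mul_right 2).mul_right C).mul_left
      _).mul_left _) (fun d => by positivity) hε hε1
  refine ⟨δ, hδ, fun k hk x hx hx0 L => hprod _ (fun d => ?_) (fun d => ?_) L⟩
  · have h1 := h.abs_pull_add_le hR hk hx (d + 1)
    refine hmask _ (by omega) _ (fun i => (h1 i).trans ?_) ?_
    · have : (2 / 3 : ℝ) ^ (d + 1) ≤ 1 := pow_le_one₀ (by norm_num) (by norm_num)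
      linarith
    · have h2 := h.mul_abs_pull_succ_le hR (by omega : 1 ≤ k + d) x
      have h3 := h.abs_pull_first_add_le hR hk x d
      rw [← div_eq_mul_inv, le_div_iff₀ hm, mul_comm]
      linarith
  · have h1 : ∀ i, |pull R (k + d + 1) x i| ≤ (2 / 3) ^ d * 2 := fun i => by
      have h2 := h.abs_pull_succ_le hR (by omega : 1 ≤ k + d) (h.abs_pull_add_le hR hk hx d) i
      have : (0 : ℝ) ≤ (2 / 3) ^ d * 2 := by positivity
      linarith
    have h3 := h.norm_mask_sub_one_le_of_abs_le hD (by omega : 1 ≤ k + d + 1) h1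
    have h4 := norm_sub_norm_le (1 : ℂ) (mask (D (k + d + 1)) (pull R (k + d + 1) x))
    rw [norm_one, norm_sub_rev] at h4
    linarith

/-- If `R k ≡ 0` mod `m` for `k ≥ 2` then the Moran measure is spectral. -/
theorem isSpectral (h : MoranData m R D ν) (hR : IsContracting m R i₀) {C : ℝ} (hC : 0 ≤ C)
    (hD : ∀ k, 1 ≤ k → ∀ d ∈ D k, ‖toE d‖ ≤ C) {μ : ProbabilityMeasure (E n)}
    (hμ : IsInfConv (factor R D) μ) : IsSpectral μ := by
  classical
  let Λ : Set (E n) := ⋃ k, (approxSpectrum m R ν k : Set (E n))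
  have hmono := h.approxSpectrum_mono
  have htend : ∀ x, Tendsto (fun k => partialSq R D k x) atTop
      (𝓝 (‖ft (μ : Measure (E n)) x‖ ^ 2)) := fun x => by
    have h1 := ((hμ.tendsto_prod ((2 * Real.pi) • x)).norm.pow 2)
    refine h1.congr fun k => ?_
    rw [norm_prod, partialSq, ← Finset.prod_pow]
    refine Finset.prod_congr rfl fun j _ => ?_
    rw [← ft_factor h.det_ne]
    rfl
  have horth : ∀ l ∈ Λ, ∀ l' ∈ Λ, l ≠ l' → ft (μ : Measure (E n)) (l - l') = 0 := by
    intro l hl l' hl' hne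
    obtain ⟨k, hk⟩ := Set.mem_iUnion.1 hl
    obtain ⟨k', hk'⟩ := Set.mem_iUnion.1 hl'
    obtain ⟨j, ⟨hj, -⟩, hj0⟩ := h.exists_mask_eq_zero hR (max k k') l
      (hmono (le_max_left k k') hk) l' (hmono (le_max_right k k') hk') hne
    obtain ⟨j, rfl⟩ := Nat.exists_eq_succ_of_ne_zero (by omega : j ≠ 0)
    rw [← ft_factor h.det_ne] at hj0
    exact hμ.charFun_eq_zero hj0
  obtain ⟨δ, hδ, htail⟩ := h.exists_le_prod_tail hR hC hD
  have hlow : ∀ k, 1 ≤ k → ∀ x, (∀ i, |pull R k x i| ≤ 2) → |pull R k x i₀| ≤ 7 / 8 →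
      partialSq R D k x * δ ^ 2 ≤ ‖ft (μ : Measure (E n)) x‖ ^ 2 := by
    intro k hk x hx hx0
    refine ge_of_tendsto (htend x) ?_
    filter_upwards [eventually_ge_atTop k] with K hK
    obtain ⟨L, rfl⟩ := Nat.exists_eq_add_of_le hK
    rw [partialSq, partialSq, Finset.prod_range_add, Finset.prod_pow _ 2 fun d =>
      ‖mask (D (k + d + 1)) (pull R (k + d + 1) x)‖]
    have := htail k hk x hx hx0 L
    gcongr
  refine isSpectral_of_hasSum μ (Λ := Λ) (Set.countable_iUnion fun k => Finset.countable_toSet _)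
    horth fun ξ => ?_
  have hsummable : Summable fun l : Λ => ‖ft (μ : Measure (E n)) (ξ + l)‖ ^ 2 := by
    have hon : Orthonormal ℂ fun l : Λ => expLp (μ : Measure (E n)) l :=
      orthonormal_expLp _ fun i j hij => horth i i.2 j j.2 fun h => hij (Subtype.ext h)
    refine (hon.inner_products_summable (expLp (μ : Measure (E n)) (-ξ))).congr fun l => ?_
    rw [inner_expLp, sub_neg_eq_add, add_comm]
  -- Extended by 0, the k-th sum becomes a sum over all of `Λ` with total 1, ready for dominated
  -- convergence.
  let f : ℕ → E n → ℝ := fun k l => if l ∈ approxSpectrum m R ν k then partialSq R D k (ξ + l) else 0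
  have hf : ∀ k, ∑' l : Λ, f k l = 1 := fun k => by
    have hsupp : Function.support (f k) ⊆ Λ := fun l hl => by
      by_contra hcon
      refine hl (if_neg fun hmem => hcon (Set.mem_iUnion.2 ⟨k, hmem⟩))
    rw [tsum_subtype Λ (f k), Set.indicator_eq_self.2 hsupp,
      tsum_eq_sum (s := approxSpectrum m R ν k) fun l hl => if_neg hl, ← h.sum_partialSq hR ξ k]
    exact Finset.sum_congr rfl fun l hl => if_pos hl
  have hpt : ∀ l : Λ, Tendsto (fun k => f k l) atTop
      (𝓝 (‖ft (μ : Measure (E n)) (ξ + l)‖ ^ 2)) := fun l => by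
    obtain ⟨k, hk⟩ := Set.mem_iUnion.1 l.2
    refine (htend (ξ + l)).congr' ?_
    filter_upwards [eventually_ge_atTop k] with K hK
    exact (if_pos (hmono hK hk)).symm
  obtain ⟨B, hB⟩ : ∃ B, ∀ i, |pull R 1 ξ i| ≤ B :=
    ⟨‖pull R 1 ξ‖, fun i => PiLp.norm_apply_le (pull R 1 ξ) i⟩
  -- With a contribution of at most 1/8 from `ξ`, the bounds 3/2 and 3/4 on the approximations
  -- become at most 2 and 7/8, as the tail estimate demands.
  have hsmall : ∀ᶠ k in atTop, (2 / 3 : ℝ) ^ k * B ≤ 1 / 8 := by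
    have := (tendsto_pow_atTop_nhds_zero_of_lt_one (r := (2 / 3 : ℝ)) (by norm_num)
      (by norm_num)).mul_const B
    rw [zero_mul] at this
    exact this.eventually_le_const (by norm_num)
  -- The dominating function is the limit itself divided by δ², which is summable by Bessel.
  have hbound : ∀ᶠ k in atTop, ∀ l : Λ,
      ‖f k l‖ ≤ (δ ^ 2)⁻¹ * ‖ft (μ : Measure (E n)) (ξ + l)‖ ^ 2 := by
    filter_upwards [(tendsto_sub_atTop_nat 1).eventually hsmall, eventually_ge_atTop 1]
      with k hk hk1 l
    obtain ⟨k, rfl⟩ := Nat.exists_eq_add_of_le' hk1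
    rw [Nat.add_sub_cancel] at hk
    simp only [f]
    split_ifs with hl
    · have hp : 0 ≤ partialSq R D (k + 1) (ξ + l) := Finset.prod_nonneg fun _ _ => by positivity
      obtain ⟨h1, h2⟩ := h.abs_pull_approxSpectrum_le hR k l hl
      have h3 : ∀ i, |pull R (k + 1) ξ i| ≤ 1 / 8 := fun i => by
        have := h.abs_pull_add_le hR le_rfl hB k i
        rw [add_comm 1 k] at this
        exact this.trans hk
      have h4 : ∀ i, |pull R (k + 1) (ξ + l) i| ≤ 1 / 8 + |pull R (k + 1) l i| := fun i => by
        rw [map_add, PiLp.add_apply]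
        exact (abs_add_le _ _).trans (add_le_add (h3 i) le_rfl)
      have h5 := hlow (k + 1) hk1 (ξ + l) (fun i => by linarith [h4 i, h1 i])
        (by linarith [h4 i₀])
      rw [Real.norm_of_nonneg hp, inv_mul_eq_div, le_div_iff₀ (by positivity)]
      exact h5
    · rw [norm_zero]
      positivity
  have hlim := tendsto_tsum_of_dominated_convergence (hsummable.mul_left _) hpt hbound
  simp only [hf] at hlim
  have := tendsto_nhds_unique hlim tendsto_const_nhds
  rw [← this]
  exact hsummable.hasSum

end MoranData

/-! ### Arithmetic and contraction of the row matrices -/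

lemma det_ne_zero_of_isExpanding {A : Matrix (Fin n) (Fin n) ℤ} (h : IsExpanding A) :
    A.det ≠ 0 := by
  have h0 : (0 : ℂ) ∉ spectrum ℂ (A.map (Int.cast : ℤ → ℂ)) := fun h0 => by
    have := h 0 h0
    rw [norm_zero] at this
    linarith
  rw [spectrum.zero_notMem_iff, Matrix.isUnit_iff_isUnit_det] at h0
  have h1 : (A.map (Int.cast : ℤ → ℂ)).det = (A.det : ℂ) := ((Int.castRingHom ℂ).map_det A).symm
  intro hA
  rw [h1, hA] at h0
  simp at h0

lemma ne_zero_of_det_rowMatrix {b : Fin n → ℤ} (h : (rowMatrix b).det ≠ 0) (i : Fin n) :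
    b i ≠ 0 := by
  have htri : (rowMatrix b).BlockTriangular id := fun i j hij => by
    simp only [id] at hij
    simp [rowMatrix, not_le.2 hij]
  rw [Matrix.det_of_isUpperTriangular htri, Finset.prod_ne_zero_iff] at h
  simpa [rowMatrix] using h i (Finset.mem_univ i)

lemma Iio_eq_empty_or (i : Fin n) : Finset.Iio i = ∅ ∨ ∃ j, Finset.Iio i = Finset.Iic j := by
  rcases Nat.eq_zero_or_pos i.1 with hi | hi
  · left
    ext l
    simp only [Finset.mem_Iio, Finset.notMem_empty, iff_false, Fin.lt_def]
    omega
  · right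
    refine ⟨⟨i - 1, by omega⟩, ?_⟩
    ext l
    simp only [Finset.mem_Iio, Finset.mem_Iic, Fin.lt_def, Fin.le_def]
    omega

lemma sum_rowMatrix_mul {A : Type*} [CommRing A] (b : Fin n → ℤ) (f : Fin n → A) (i : Fin n) :
    ∑ l, (rowMatrix b l i : A) * f l = ∑ l ∈ Finset.Iic i, (b l : A) * f l := by
  rw [← Finset.sum_filter_add_sum_filter_not _ (· ≤ i)]
  have h1 : ∑ l ∈ Finset.univ.filter (fun l => ¬ l ≤ i), (rowMatrix b l i : A) * f l = 0 :=
    Finset.sum_eq_zero fun l hl => by simp [rowMatrix, (Finset.mem_filter.1 hl).2]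
  rw [h1, add_zero]
  refine Finset.sum_congr (by ext; simp) fun l hl => ?_
  simp [rowMatrix, Finset.mem_Iic.1 hl]

lemma sum_Iio_add {A : Type*} [AddCommMonoid A] (f : Fin n → A) (i : Fin n) :
    ∑ l ∈ Finset.Iio i, f l + f i = ∑ l ∈ Finset.Iic i, f l := by
  rw [add_comm, ← Finset.sum_insert (by simp), Finset.Iio_insert]

/-- The transpose produces the partial sums of b_l v_l; differences of consecutive ones isolate b_i
v_i, and v_i is invertible mod m. -/
lemma dvd_of_dvd_rowMatrix_transpose_mulVec {m : ℕ} (hm : m.Prime) {b v : Fin n → ℤ}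
    (hv : ∀ i, ¬ (m : ℤ) ∣ v i)
    (h : ∀ i, (m : ℤ) ∣ (rowMatrix b).transpose.mulVec v i) (i : Fin n) : (m : ℤ) ∣ b i := by
  have h1 : ∀ i, (m : ℤ) ∣ ∑ l ∈ Finset.Iic i, b l * v l := fun i => by
    have h2 := sum_rowMatrix_mul b v i
    simp only [Int.cast_id] at h2
    rw [← h2]
    exact h i
  have h3 : (m : ℤ) ∣ ∑ l ∈ Finset.Iio i, b l * v l := by
    rcases Iio_eq_empty_or i with hi | ⟨j, hj⟩
    · simp [hi]
    · rw [hj]; exact h1 j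
  have h4 : (m : ℤ) ∣ b i * v i := by
    rw [← dvd_add_right h3, sum_Iio_add (fun l => b l * v l)]
    exact h1 i
  exact ((Nat.prime_iff_prime_int.1 hm).dvd_or_dvd h4).resolve_right (hv i)

/-- Again b_i x_i is a difference of two consecutive partial sums, which costs the factor 2. With
|b_i| ≥ m ≥ 3 this gives the contraction 2/3. -/
lemma abs_mul_le_of_act_rowMatrix {b : Fin n → ℤ} {x : E n} {B : ℝ}
    (hx : ∀ i, |act (rowMatrix b) x i| ≤ B) (i : Fin n) : |(b i : ℝ) * x i| ≤ 2 * B := by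
  simp only [act_apply, sum_rowMatrix_mul b (fun l => x l)] at hx
  have hB : 0 ≤ B := (abs_nonneg _).trans (hx i)
  have h1 : |∑ l ∈ Finset.Iio i, (b l : ℝ) * x l| ≤ B := by
    rcases Iio_eq_empty_or i with hi | ⟨j, hj⟩
    · simpa [hi] using hB
    · rw [hj]; exact hx j
  have h2 := hx i
  rw [← sum_Iio_add (fun l => (b l : ℝ) * x l)] at h2
  rw [abs_le] at *
  constructor <;> linarith

lemma isContracting_of_rowMatrix {m : ℕ} (hm : 2 < m) {a : ℕ → Fin n → ℤ}
    {R : ℕ → Matrix (Fin n) (Fin n) ℤ} (hR : ∀ k, 1 ≤ k → R k = rowMatrix (a k))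
    (hdet : ∀ k, 1 ≤ k → (R k).det ≠ 0) (hdvd : ∀ k, 2 ≤ k → ∀ i, (m : ℤ) ∣ a k i) (hn : 0 < n) :
    IsContracting m R ⟨0, hn⟩ := by
  have hle : ∀ k, 2 ≤ k → ∀ i, (m : ℝ) ≤ |(a k i : ℝ)| := fun k hk i => by
    have hdet' := hdet k (by omega)
    rw [hR k (by omega)] at hdet'
    have h1 := Int.le_of_dvd (abs_pos.2 (ne_zero_of_det_rowMatrix hdet' i))
      ((dvd_abs _ _).2 (hdvd k hk i))
    exact_mod_cast h1
  refine ⟨hm, fun k hk i j => ?_, fun k hk x B hx i => ?_, fun k hk x => ?_⟩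
  · rw [hR k (by omega), rowMatrix, Matrix.of_apply]
    split_ifs
    · exact hdvd k hk i
    · exact dvd_zero _
  · rw [hR k (by omega)] at hx
    have h1 := abs_mul_le_of_act_rowMatrix hx i
    rw [abs_mul] at h1
    have h2 : (3 : ℝ) * |x i| ≤ |(a k i : ℝ)| * |x i| := by
      have : (3 : ℝ) ≤ m := by exact_mod_cast hm
      exact mul_le_mul_of_nonneg_right (this.trans (hle k hk i)) (abs_nonneg _)
    linarith
  -- The first partial sum has a single term, so here no factor 2 is lost.
  · rw [hR k (by omega), act_apply, sum_rowMatrix_mul (a k) (fun l => x l)]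
    have h1 : Finset.Iic (⟨0, hn⟩ : Fin n) = {⟨0, hn⟩} := by
      ext l
      simp [Fin.le_def, Fin.ext_iff]
    rw [h1, Finset.sum_singleton, abs_mul]
    exact mul_le_mul_of_nonneg_right (hle k hk _) (abs_nonneg _)

lemma ZerosDecompose.exists_mask_eq_zero_iff {m : ℕ} {D : Finset (Fin n → ℤ)}
    (h : ZerosDecompose m D 1) : ∃ ν : Fin n → ℤ, (∀ i, 1 ≤ ν i ∧ ν i ≤ (m : ℤ) - 1) ∧
      ∀ x, mask D x = 0 ↔
        ∃ c : ℕ, (1 ≤ c ∧ c ≤ m - 1) ∧ ∃ z, x = ((c : ℝ) / (m : ℝ)) • toE ν + toE z := by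
  obtain ⟨ν, hν, -, heq⟩ := h
  refine ⟨ν 0, hν 0, fun x => ?_⟩
  have h1 : mask D x = 0 ↔ x ∈ maskZeros D := Iff.rfl
  rw [h1, heq]
  simp only [zeroPiece, Set.mem_iUnion, Unique.exists_iff, Fin.default_eq_zero, Set.mem_ofPred_eq,
    Set.mem_Icc, exists_prop]

end Moran

end

/-! ### The main theorem -/

open Moran in
theorem mainTheorem4 {n m : ℕ} (hm : m.Prime) (hm2 : 2 < m)
    (a : ℕ → Fin n → ℤ) (R : ℕ → Matrix (Fin n) (Fin n) ℤ) (D : ℕ → Finset (Fin n → ℤ))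
    (hR : ∀ k, 1 ≤ k → R k = Moran.rowMatrix (a k))
    (hexp : ∀ k, 1 ≤ k → Moran.IsExpanding (R k))
    (hlim : limsup
      (fun k => ‖Matrix.toEuclideanCLM (n := Fin n) (𝕜 := ℝ) (Moran.realInv (R k))‖ₑ) atTop < 1)
    (hbdd : BddAbove {t : ℝ | ∃ k, 1 ≤ k ∧ ∃ d ∈ D k, t = ‖Moran.toE d‖})
    (hcard : ∀ k, 1 ≤ k → (D k).card = m)
    (hzero : ∀ k, 1 ≤ k → Moran.ZerosDecompose m (D k) 1) :
    ∃ μ : ProbabilityMeasure (Moran.E n), Moran.IsMoranMeasure R D μ ∧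
      (Moran.IsSpectral μ ↔ ∀ k, 2 ≤ k → ∀ i, (m : ℤ) ∣ a k i) := by
  -- For n = 0 there is only one integer vector, too few for m digits.
  have hn : 0 < n := by
    rcases Nat.eq_zero_or_pos n with rfl | hn
    · have := hcard 1 le_rfl ▸ Finset.card_le_one_of_subsingleton (D 1)
      omega
    · exact hn
  choose! ν hν hmask using fun k hk => (hzero k hk).exists_mask_eq_zero_iff
  have hdet : ∀ k, 1 ≤ k → (R k).det ≠ 0 := fun k hk => det_ne_zero_of_isExpanding (hexp k hk)
  have hdata : MoranData m R D ν := ⟨hm, hdet, hcard, hν, hmask⟩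
  obtain ⟨C, hC⟩ := hbdd
  have hD : ∀ k, 1 ≤ k → ∀ d ∈ D k, ‖toE d‖ ≤ C := fun k hk d hd => hC ⟨k, hk, d, hd, rfl⟩
  have hC0 : 0 ≤ C := by
    obtain ⟨d, hd⟩ := Finset.card_pos.1 (hcard 1 le_rfl ▸ hm.pos)
    exact (norm_nonneg _).trans (hD 1 le_rfl d hd)
  have hprob : ∀ j, IsProbabilityMeasure (factor R D j) := fun j =>
    isProbabilityMeasure_uniformDirac (Finset.card_pos.1 (by
      rw [card_imageSet hdet, hcard _ (by omega)]
      exact hm.pos))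
  have hsum : Summable fun j =>
      ‖Matrix.toEuclideanCLM (n := Fin n) (𝕜 := ℝ) (invProd R (j + 1))‖ * C :=
    ((summable_nat_add_iff 1).2 (summable_norm_invProd hlim)).mul_right C
  obtain ⟨μ, hμ⟩ := exists_isInfConv hsum (ae_norm_factor_le R hD)
  refine ⟨μ, fun f => by simpa only [partialMoran_eq] using hμ.tendsto_integral f, fun hspec => ?_,
    fun hdvd => hdata.isSpectral (isContracting_of_rowMatrix hm2 hR hdet hdvd hn) hC0 hD hμ⟩
  have hall := hdata.dvd_of_isSpectral ⟨0, hn⟩ (fun k hk hdiv i j => ?_) hsum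
    (ae_norm_factor_le R hD) hμ hspec
  · intro k hk i
    have := hall k hk i i
    rwa [hR k (by omega), rowMatrix, Matrix.of_apply, if_pos le_rfl] at this
  · rw [hR k (by omega)] at hdiv ⊢
    rw [rowMatrix, Matrix.of_apply]
    split_ifs
    · exact dvd_of_dvd_rowMatrix_transpose_mulVec hm
        (fun i => hdata.not_dvd_ν (by omega) i) hdiv i
    · exact dvd_zero _
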